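/- Let $X\subset\mathbb R^d$ and $Y\subset\mathbb R^{d'}$ be compact convex sets, let $P$ be a probability measure on a space $Z$, and let $f(x,y;z)$ be a real cost such that, for every $z$, $f(\cdot,\cdot;z)$ is $\beta$-smooth on $X\times Y$ (differentiable, with $\beta$-Lipschitz gradient $(\nabla_x f,\nabla_y f)$) and $f(x,\cdot;z)$ is $\mu_y$-strongly concave on $Y$ for every $x\in X$, where $\beta,\mu_y>0$. Let $$F(x,y)=\mathbb E_{z\sim P}f(x,y;z),\quad \Phi(x)=\max_{y\in Y}F(x,y),\qquad F_S(x,y)=\tfrac1n\sum_{i=1}^n f(x,y;z_i),\quad \Phi_S(x)=\max_{y\in Y}F_S(x,y),$$ where $S=(z_1,\dots,z_n)$ is an i.i.d. sample from $P$, $n\ge 1$. Assume that for some $\mu_x>0$ the Polyak–Łojasiewicz condition $F(x,y)-\inf_{x'\in X}F(x',y)\le\frac1{2\mu_x}\|\nabla_xF(x,y)\|^2$ holds for all $x\in X$, $y\in Y$. Let $(x^*,y^*)$ be the solution of $\min_{x\in X}\max_{y\in Y}F(x,y)$: $x^*$ is the unique minimizer of $\Phi$ over $X$, it lies in the interior of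 $X$, and $y^*$ maximizes $F(x^*,\cdot)$ over $Y$. Finally assume the Bernstein conditions at $(x^*,y^*)$: for some $B_{x^*},B_{y^*}>0$ and all integers $k\ge2$, $$\mathbb E\|\nabla_xf(x^*,y^*;z)\|^k\le\tfrac{k!}2\,\mathbb E\|\nabla_xf(x^*,y^*;z)\|^2\,B_{x^*}^{k-2},\qquad \mathbb E\|\nabla_yf(x^*,y^*;z)\|^k\le\tfrac{k!}2\,\mathbb E\|\nabla_yf(x^*,y^*;z)\|^2\,B_{y^*}^{k-2}.$$ Then there are an absolute constant $C_1$ and a constant $C_2$ that depends only on the population problem ($X$, $Y$, $F$ and the parameters $\beta,\mu_x,\mu_y,B_{x^*},B_{y^*}$), and not on $n$, on the sample, on $P$ or on the cost $f$ otherwise, such that for every $n\ge1$ and every random point $x$ of $X$, which may depend on $S$ in any way (for instance the output of an algorithm run on $S$), both expectations on the left and right below are finite and $$\mathbb E[\Phi(x)-\Phi(x^*)]\le\frac{8\,\mathbb E\|\nabla\Phi_S(x)\|^2}{\mu_x}+C_1\left(\frac{\mathbb E\|\nabla_xf(x^*,y^*;z)\|^2}{\mu_x n}+\frac{\beta^2\,\mathbb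 E\|\nabla_yf(x^*,y^*;z)\|^2}{\mu_x\mu_y^2 n}\right)+\frac{C_2}{n^2}.$$ (Gradients of $F(\cdot,y)$, $\Phi$ and $\Phi_S$ at boundary points of $X$ are taken relative to $X$.) -/

import Mathlib

open MeasureTheory ProbabilityTheory

noncomputable section

/-- The Euclidean space `ℝᵈ`. -/
abbrev Euc (d : ℕ) : Type := EuclideanSpace ℝ (Fin d)

/-- Population risk `F(x, y) = 𝔼_{z ∼ P} f(x, y; z)`. -/
def populationRisk {d d' : ℕ} {Z : Type*} [MeasurableSpace Z] (P : Measure Z)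
    (f : Euc d → Euc d' → Z → ℝ) (x : Euc d) (y : Euc d') : ℝ :=
  ∫ z, f x y z ∂P

/-- Empirical risk `F_S(x, y) = (1/n) ∑ᵢ f(x, y; zᵢ)` of the sample `S = (z₁, …, zₙ)`. -/
def empiricalRisk {d d' n : ℕ} {Z : Type*} (f : Euc d → Euc d' → Z → ℝ) (S : Fin n → Z)
    (x : Euc d) (y : Euc d') : ℝ :=
  (1 / (n : ℝ)) * ∑ i, f x y (S i)

/-- Primal function `x ↦ max_{y ∈ Y} G(x, y)` of an objective `G`. -/
def primal {d d' : ℕ} (Y : Set (Euc d')) (G : Euc d → Euc d' → ℝ) (x : Euc d) : ℝ :=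
  sSup (G x '' Y)

/-- `∇ₓ f(x, y; z)`. -/
def gradX {d d' : ℕ} {Z : Type*} (f : Euc d → Euc d' → Z → ℝ)
    (x : Euc d) (y : Euc d') (z : Z) : Euc d :=
  gradient (fun u => f u y z) x

/-- `∇_y f(x, y; z)`. -/
def gradY {d d' : ℕ} {Z : Type*} (f : Euc d → Euc d' → Z → ℝ)
    (x : Euc d) (y : Euc d') (z : Z) : Euc d' :=
  gradient (fun v => f x v z) y

/-- `f(·, ·; z)` is differentiable at the points of `X × Y`, jointly in both variables, with
`β`-Lipschitz gradient `(∇ₓ f, ∇_y f)` there, for every `z`. -/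
structure IsSmoothOn {d d' : ℕ} {Z : Type*} (f : Euc d → Euc d' → Z → ℝ)
    (X : Set (Euc d)) (Y : Set (Euc d')) (β : ℝ) : Prop where
  differentiable : ∀ z, ∀ x ∈ X, ∀ y ∈ Y,
    DifferentiableAt ℝ (fun p : Euc d × Euc d' => f p.1 p.2 z) (x, y)
  lipschitz : ∀ z, ∀ x₁ ∈ X, ∀ x₂ ∈ X, ∀ y₁ ∈ Y, ∀ y₂ ∈ Y,
    √(‖gradX f x₁ y₁ z - gradX f x₂ y₂ z‖ ^ 2 + ‖gradY f x₁ y₁ z - gradY f x₂ y₂ z‖ ^ 2)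
      ≤ β * √(‖x₁ - x₂‖ ^ 2 + ‖y₁ - y₂‖ ^ 2)

/-- Nonconvex-strongly-concave problem: `X` and `Y` are compact convex sets, and for every `z` the
cost `f(·, ·; z)` is `β`-smooth on `X × Y` and `μy`-strongly concave in `y ∈ Y`. -/
structure IsNCSC {d d' : ℕ} {Z : Type*} (f : Euc d → Euc d' → Z → ℝ)
    (X : Set (Euc d)) (Y : Set (Euc d')) (β μy : ℝ) : Prop where
  compact_X : IsCompact X
  convex_X : Convex ℝ X
  compact_Y : IsCompact Y
  convex_Y : Convex ℝ Y
  smooth : IsSmoothOn f X Y β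
  strongConcave : ∀ z, ∀ x ∈ X, StrongConcaveOn Y μy (fun y => f x y z)

/-- The expectations of the cost exist on `X × Y`, and the gradients are measurable in `z`. -/
structure IsRegularCost {d d' : ℕ} {Z : Type*} [MeasurableSpace Z] (P : Measure Z)
    (f : Euc d → Euc d' → Z → ℝ) (X : Set (Euc d)) (Y : Set (Euc d')) : Prop where
  integrable : ∀ x ∈ X, ∀ y ∈ Y, Integrable (f x y) P
  measurable_gradX : ∀ x ∈ X, ∀ y ∈ Y, AEStronglyMeasurable (gradX f x y) P
  measurable_gradY : ∀ x ∈ X, ∀ y ∈ Y, AEStronglyMeasurable (gradY f x y) P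

/-- Bernstein condition with parameter `B` for a random vector `g`:
`𝔼‖g‖ᵏ ≤ (k!/2) 𝔼‖g‖² Bᵏ⁻²` for all `k ≥ 2`. -/
def BernsteinCondition {d : ℕ} {Z : Type*} [MeasurableSpace Z] (P : Measure Z)
    (g : Z → Euc d) (B : ℝ) : Prop :=
  ∀ k : ℕ, 2 ≤ k → Integrable (fun z => ‖g z‖ ^ k) P ∧
    ∫ z, ‖g z‖ ^ k ∂P ≤ (k.factorial : ℝ) / 2 * (∫ z, ‖g z‖ ^ 2 ∂P) * B ^ (k - 2)

/-- The `x`-side Polyak–Łojasiewicz condition with parameter `μx` for `F` on `X × Y`. Gradients of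
functions that are only controlled on `X` are taken relative to `X`; when `X` is convex with nonempty
interior this is the usual gradient, one-sided at boundary points of `X`. -/
def IsPLX {d d' : ℕ} (F : Euc d → Euc d' → ℝ) (X : Set (Euc d)) (Y : Set (Euc d'))
    (μx : ℝ) : Prop :=
  ∀ y ∈ Y, ∀ x ∈ X,
    F x y - sInf ((fun x' => F x' y) '' X)
      ≤ 1 / (2 * μx) * ‖gradientWithin (fun x' => F x' y) X x‖ ^ 2

/-- `(xs, ys)` is the solution of `min_{x ∈ X} max_{y ∈ Y} F(x, y)`: `xs` is the unique minimizer
over `X` of the primal function, it lies in the interior of `X`, and `ys` maximizes `F(xs, ·)`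
over `Y`. -/
structure IsMinimaxSolution {d d' : ℕ} (F : Euc d → Euc d' → ℝ) (X : Set (Euc d))
    (Y : Set (Euc d')) (xs : Euc d) (ys : Euc d') : Prop where
  mem_interior : xs ∈ interior X
  lt_primal : ∀ x ∈ X, x ≠ xs → primal Y F xs < primal Y F x
  mem_Y : ys ∈ Y
  isMaxOn : IsMaxOn (F xs) Y ys

end

/-! Write `Φ` for the primal function of `F` and `y(x)` for the maximizer of `F x`. By Danskin,
`∇Φ(x) = ∇ₓF(x, y(x))`. Applying the PL inequality of `F` at `y = y(x)` gives one for `Φ`, so the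
gap `Φ(x) - Φ(x*)` is controlled by `‖∇Φ(x)‖²` (`primal_sub_le`). Strong concavity makes maximizers
stable, and `‖∇Φ(x)‖` exceeds `‖∇Φ_S(x)‖` by at most the deviations of `∇ₓF_S` and `∇_yF_S` from
their means at `(x, y(x))`, the latter weighted by `κ = β/μy` (`norm_gradient_primal_le`). Since
`y(x)` is the population maximizer, these are centred empirical means of a fixed Lipschitz family
indexed by `x` alone.

A crude uniform bound over `x` would put dimension factors into the `1/n` term. Instead the
deviation is localized at `x*`. Off an event of probability `O(1/n²)`, it differs from its value at
`x*` by at most `ε‖x - x*‖ + O(1/n)`, for all `x` at once (`exists_uniform_deviation`), so a point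
depending on the sample is allowed. PL together with a unique interior minimizer gives quadratic
growth `‖x - x*‖² ≤ c (Φ(x) - Φ(x*))` (`exists_quadratic_growth`), so for a suitable fixed `ε` the
localized term is absorbed into the left side (`gap_le_of_gradient_deviation`). The deviations at
`x*` have second moment at most that of the gradient divided by `n`. On the exceptional event the
gap is bounded by its maximum over `X`, which costs only `O(1/n²)`.

The analysis is carried out for `IsSaddleObjective`, a list of inequalities stable under averaging;
hence it applies alike to each `f(·,·;z)`, to `F_S` and to `F`. -/

open scoped InnerProductSpace Topology

noncomputable section

/-! ### First-order calculus with quadratic remainders. -/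

section QuadraticBounds

variable {E : Type*} [NormedAddCommGroup E] [InnerProductSpace ℝ E]

/-- A function with Lipschitz gradient on a convex set has a quadratic Taylor remainder. -/
theorem abs_sub_sub_inner_le_of_lipschitz_gradient [CompleteSpace E] {s : Set E} (hs : Convex ℝ s) {g : E → ℝ}
    {g' : E → E} {β : ℝ} (hβ : 0 ≤ β) (hg : ∀ x ∈ s, HasGradientAt g (g' x) x)
    (hlip : ∀ x ∈ s, ∀ y ∈ s, ‖g' x - g' y‖ ≤ β * ‖x - y‖) {x y : E} (hx : x ∈ s) (hy : y ∈ s) :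
    |g y - g x - ⟪g' x, y - x⟫_ℝ| ≤ β * ‖y - x‖ ^ 2 := by
  set φ : ℝ → ℝ := fun t => g (x + t • (y - x)) with hφ
  have hmem : ∀ t ∈ Set.Icc (0 : ℝ) 1, x + t • (y - x) ∈ s := fun t ht =>
    hs.add_smul_sub_mem hx hy ht
  have hd : ∀ t ∈ Set.Icc (0 : ℝ) 1, HasDerivAt φ ⟪g' (x + t • (y - x)), y - x⟫_ℝ t := by
    intro t ht
    have h1 : HasDerivAt (fun t : ℝ => x + t • (y - x)) (y - x) t := by
      simpa using ((hasDerivAt_id t).smul_const (y - x)).const_add x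
    have h2 : HasDerivAt φ _ t := (hg _ (hmem t ht)).hasFDerivAt.comp_hasDerivAt t h1
    simpa only [InnerProductSpace.toDual_apply_apply] using h2
  obtain ⟨t, ht, hteq⟩ := exists_hasDerivAt_eq_slope φ _ (by norm_num : (0 : ℝ) < 1)
    (fun t ht => (hd t ht).continuousAt.continuousWithinAt)
    (fun t ht => hd t (Set.Ioo_subset_Icc_self ht))
  have h01 : g y - g x = ⟪g' (x + t • (y - x)), y - x⟫_ℝ := by
    rw [hteq]; simp [hφ]
  rw [h01, ← inner_sub_left]
  have ht' := Set.Ioo_subset_Icc_self ht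
  have h3 := hlip _ (hmem t ht') _ hx
  have h4 : ‖x + t • (y - x) - x‖ ≤ ‖y - x‖ := by
    rw [add_sub_cancel_left, norm_smul, Real.norm_of_nonneg ht'.1]
    exact mul_le_of_le_one_left (norm_nonneg _) ht'.2
  calc |⟪g' (x + t • (y - x)) - g' x, y - x⟫_ℝ|
      ≤ ‖g' (x + t • (y - x)) - g' x‖ * ‖y - x‖ := abs_real_inner_le_norm _ _
    _ ≤ (β * ‖y - x‖) * ‖y - x‖ := by
        gcongr
        exact h3.trans (by gcongr)
    _ = β * ‖y - x‖ ^ 2 := by ring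

theorem hasGradientWithinAt_of_abs_sub_le [CompleteSpace E] {s : Set E} {g : E → ℝ} {v x : E} {K : ℝ}
    (h : ∀ y ∈ s, |g y - g x - ⟪v, y - x⟫_ℝ| ≤ K * ‖y - x‖ ^ 2) :
    HasGradientWithinAt g v s x := by
  rw [hasGradientWithinAt_iff_isLittleO]
  have h1 : (fun y => g y - g x - ⟪v, y - x⟫_ℝ) =O[𝓝[s] x] fun y => ‖y - x‖ ^ 2 := by
    refine Asymptotics.IsBigO.of_bound K ?_
    filter_upwards [self_mem_nhdsWithin] with y hy
    simpa using h y hy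
  refine h1.trans_isLittleO ?_
  have h2 : (fun y : E => y - x) =o[𝓝[s] x] fun _ => (1 : ℝ) := by
    rw [Asymptotics.isLittleO_one_iff]
    have : Filter.Tendsto (fun y : E => y - x) (𝓝 x) (𝓝 (x - x)) := by
      exact (continuous_id.sub continuous_const).tendsto x
    rw [sub_self] at this
    exact this.mono_left nhdsWithin_le_nhds
  have h3 := h2.norm_left.mul_isBigO (Asymptotics.isBigO_refl (fun y : E => ‖y - x‖) (𝓝[s] x))
  simpa [pow_two] using h3

theorem continuousOn_of_abs_sub_le [CompleteSpace E] {s : Set E} {g : E → ℝ} {v : E → E} {K : ℝ}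
    (h : ∀ x ∈ s, ∀ y ∈ s, |g y - g x - ⟪v x, y - x⟫_ℝ| ≤ K * ‖y - x‖ ^ 2) :
    ContinuousOn g s := fun x hx =>
  (hasGradientWithinAt_of_abs_sub_le (h x hx)).differentiableWithinAt.continuousWithinAt

/-- A convex set with nonempty interior has unique derivatives at all its points, boundary included,
so a first-order expansion along the set determines the relative gradient. -/
theorem gradientWithin_eq_of_abs_sub_le [CompleteSpace E] {s : Set E} (hs : Convex ℝ s)
    (hint : (interior s).Nonempty) {g : E → ℝ} {v x : E} {K : ℝ} (hx : x ∈ s)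
    (h : ∀ y ∈ s, |g y - g x - ⟪v, y - x⟫_ℝ| ≤ K * ‖y - x‖ ^ 2) :
    gradientWithin g s x = v := by
  have h1 := (hasGradientWithinAt_of_abs_sub_le h).hasFDerivWithinAt
  have h2 := h1.fderivWithin (uniqueDiffOn_convex hs hint x hx)
  rw [gradientWithin, h2]
  simp

/-- If `a * t ≤ b * t ^ 2` for all small `t > 0`, then `a ≤ 0`. -/
theorem nonpos_of_forall_mul_le_sq {a b : ℝ}
    (h : ∀ t : ℝ, 0 < t → t ≤ 1 → a * t ≤ b * t ^ 2) : a ≤ 0 := by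
  by_contra! ha
  have hb : 0 < b := by nlinarith [h 1 one_pos le_rfl]
  -- At this `t` the right side is at most half of the left side.
  have ht : 0 < min 1 (a / (2 * b)) := by positivity
  have h1 := h _ ht (min_le_left _ _)
  have h2 : min 1 (a / (2 * b)) * b ≤ a / 2 := by
    calc _ ≤ (a / (2 * b)) * b := by gcongr; exact min_le_right _ _
      _ = a / 2 := by field_simp
  nlinarith

/-- The variational inequality at a constrained maximizer: a step of length `t` towards `y` gains `t
⟪v, y - x⟫` up to `O(t²)`, and cannot gain anything. -/
theorem inner_le_zero_of_isMaxOn {s : Set E} (hs : Convex ℝ s) {g : E → ℝ} {v x : E} {K : ℝ}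
    (hx : x ∈ s) (h : ∀ y ∈ s, |g y - g x - ⟪v, y - x⟫_ℝ| ≤ K * ‖y - x‖ ^ 2)
    (hmax : IsMaxOn g s x) {y : E} (hy : y ∈ s) : ⟪v, y - x⟫_ℝ ≤ 0 := by
  refine nonpos_of_forall_mul_le_sq (b := K * ‖y - x‖ ^ 2) fun t ht ht1 => ?_
  have hm := hs.add_smul_sub_mem hx hy ⟨ht.le, ht1⟩
  have h1 := (abs_le.1 (h _ hm)).1
  have h2 := isMaxOn_iff.1 hmax _ hm
  rw [add_sub_cancel_left, inner_smul_right, norm_smul, Real.norm_of_nonneg ht.le] at h1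
  nlinarith

/-- Insert the Taylor bound at `x + t (y - x)` into strong concavity along the segment; the
inequality is the coefficient of `t` as `t → 0`. -/
theorem StrongConcaveOn.le_add_inner_sub {s : Set E} {g : E → ℝ} {μ : ℝ}
    (hc : StrongConcaveOn s μ g) {v x : E} {K : ℝ} (hx : x ∈ s)
    (h : ∀ y ∈ s, |g y - g x - ⟪v, y - x⟫_ℝ| ≤ K * ‖y - x‖ ^ 2) {y : E} (hy : y ∈ s) :
    g y ≤ g x + ⟪v, y - x⟫_ℝ - μ / 2 * ‖y - x‖ ^ 2 := by
  have : g y - g x - ⟪v, y - x⟫_ℝ + μ / 2 * ‖y - x‖ ^ 2 ≤ 0 := by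
    refine nonpos_of_forall_mul_le_sq (b := (K + μ / 2) * ‖y - x‖ ^ 2) fun t ht ht1 => ?_
    have hm := hc.1.add_smul_sub_mem hx hy ⟨ht.le, ht1⟩
    have h1 := (abs_le.1 (h _ hm)).2
    have h2 := hc.2 hx hy (sub_nonneg.2 ht1) ht.le (by ring)
    have h3 : (1 - t) • x + t • y = x + t • (y - x) := by module
    rw [h3, norm_sub_rev x y] at h2
    rw [add_sub_cancel_left, inner_smul_right, norm_smul, Real.norm_of_nonneg ht.le] at h1
    simp only [smul_eq_mul] at h2
    nlinarith
  linarith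

end QuadraticBounds

/-! ### Smooth strongly concave objectives: maximizers and the primal function. -/

/-- First-order description of a smooth objective on `X × Y` that is strongly concave in `y`,
with partial gradients `gx` and `gy`. -/
structure IsSaddleObjective {d d' : ℕ} (X : Set (Euc d)) (Y : Set (Euc d'))
    (H : Euc d → Euc d' → ℝ) (gx : Euc d → Euc d' → Euc d) (gy : Euc d → Euc d' → Euc d')
    (β μ : ℝ) : Prop where
  taylor_x : ∀ y ∈ Y, ∀ x ∈ X, ∀ x' ∈ X,
    |H x' y - H x y - ⟪gx x y, x' - x⟫_ℝ| ≤ β * ‖x' - x‖ ^ 2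
  taylor_y : ∀ x ∈ X, ∀ y ∈ Y, ∀ y' ∈ Y,
    |H x y' - H x y - ⟪gy x y, y' - y⟫_ℝ| ≤ β * ‖y' - y‖ ^ 2
  concave_y : ∀ x ∈ X, ∀ y ∈ Y, ∀ y' ∈ Y,
    H x y' ≤ H x y + ⟪gy x y, y' - y⟫_ℝ - μ / 2 * ‖y' - y‖ ^ 2
  lip_x : ∀ x₁ ∈ X, ∀ x₂ ∈ X, ∀ y₁ ∈ Y, ∀ y₂ ∈ Y,
    ‖gx x₁ y₁ - gx x₂ y₂‖ ≤ β * (‖x₁ - x₂‖ + ‖y₁ - y₂‖)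
  lip_y : ∀ x₁ ∈ X, ∀ x₂ ∈ X, ∀ y₁ ∈ Y, ∀ y₂ ∈ Y,
    ‖gy x₁ y₁ - gy x₂ y₂‖ ≤ β * (‖x₁ - x₂‖ + ‖y₁ - y₂‖)

variable {d d' : ℕ}

theorem IsNCSC.isSaddleObjective {Z : Type*} {f : Euc d → Euc d' → Z → ℝ} {X : Set (Euc d)}
    {Y : Set (Euc d')} {β μ : ℝ} (h : IsNCSC f X Y β μ) (hβ : 0 < β) (z : Z) :
    IsSaddleObjective X Y (fun x y => f x y z) (fun x y => gradX f x y z)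
      (fun x y => gradY f x y z) β μ := by
  have key : ∀ a b : ℝ, 0 ≤ a → 0 ≤ b → √(a ^ 2 + b ^ 2) ≤ a + b := fun a b ha hb => by
    rw [Real.sqrt_le_left (by positivity)]; nlinarith [mul_nonneg ha hb]
  have lipx : ∀ x₁ ∈ X, ∀ x₂ ∈ X, ∀ y₁ ∈ Y, ∀ y₂ ∈ Y,
      ‖gradX f x₁ y₁ z - gradX f x₂ y₂ z‖ ≤ β * (‖x₁ - x₂‖ + ‖y₁ - y₂‖) := by
    intro x₁ hx₁ x₂ hx₂ y₁ hy₁ y₂ hy₂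
    refine le_trans ?_ ((h.smooth.lipschitz z x₁ hx₁ x₂ hx₂ y₁ hy₁ y₂ hy₂).trans
      (mul_le_mul_of_nonneg_left (key _ _ (norm_nonneg _) (norm_nonneg _)) hβ.le))
    exact Real.le_sqrt_of_sq_le (by nlinarith [sq_nonneg ‖gradY f x₁ y₁ z - gradY f x₂ y₂ z‖])
  have lipy : ∀ x₁ ∈ X, ∀ x₂ ∈ X, ∀ y₁ ∈ Y, ∀ y₂ ∈ Y,
      ‖gradY f x₁ y₁ z - gradY f x₂ y₂ z‖ ≤ β * (‖x₁ - x₂‖ + ‖y₁ - y₂‖) := by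
    intro x₁ hx₁ x₂ hx₂ y₁ hy₁ y₂ hy₂
    refine le_trans ?_ ((h.smooth.lipschitz z x₁ hx₁ x₂ hx₂ y₁ hy₁ y₂ hy₂).trans
      (mul_le_mul_of_nonneg_left (key _ _ (norm_nonneg _) (norm_nonneg _)) hβ.le))
    exact Real.le_sqrt_of_sq_le (by nlinarith [sq_nonneg ‖gradX f x₁ y₁ z - gradX f x₂ y₂ z‖])
  have hgx : ∀ y ∈ Y, ∀ x ∈ X, HasGradientAt (fun u => f u y z) (gradX f x y z) x := by
    intro y hy x hx
    have h1 := h.smooth.differentiable z x hx y hy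
    have h2 : DifferentiableAt ℝ (fun u : Euc d => (u, y)) x := by fun_prop
    exact (DifferentiableAt.comp (f := fun u : Euc d => (u, y))
      (g := fun p : Euc d × Euc d' => f p.1 p.2 z) x h1 h2).hasGradientAt
  have hgy : ∀ x ∈ X, ∀ y ∈ Y, HasGradientAt (fun v => f x v z) (gradY f x y z) y := by
    intro x hx y hy
    have h1 := h.smooth.differentiable z x hx y hy
    have h2 : DifferentiableAt ℝ (fun v : Euc d' => (x, v)) y := by fun_prop
    exact (DifferentiableAt.comp (f := fun v : Euc d' => (x, v))
      (g := fun p : Euc d × Euc d' => f p.1 p.2 z) y h1 h2).hasGradientAt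
  have ty : ∀ x ∈ X, ∀ y ∈ Y, ∀ y' ∈ Y,
      |f x y' z - f x y z - ⟪gradY f x y z, y' - y⟫_ℝ| ≤ β * ‖y' - y‖ ^ 2 := by
    intro x hx y hy y' hy'
    exact abs_sub_sub_inner_le_of_lipschitz_gradient h.convex_Y hβ.le (hgy x hx)
      (fun a ha b hb => by simpa using lipy x hx x hx a ha b hb) hy hy'
  refine ⟨fun y hy x hx x' hx' => ?_, ty, fun x hx y hy y' hy' => ?_, lipx, lipy⟩
  · exact abs_sub_sub_inner_le_of_lipschitz_gradient h.convex_X hβ.le (hgx y hy)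
      (fun a ha b hb => by simpa using lipx a ha b hb y hy y hy) hx hx'
  · exact (h.strongConcave z x hx).le_add_inner_sub hy (ty x hx y hy) hy'

/-- Every defining condition is an affine inequality or a norm bound with constants independent of
`t`, hence survives averaging. -/
theorem IsSaddleObjective.integral {T : Type*} [MeasurableSpace T] (ν : Measure T)
    [IsProbabilityMeasure ν] {X : Set (Euc d)} {Y : Set (Euc d')}
    {H : T → Euc d → Euc d' → ℝ} {gx : T → Euc d → Euc d' → Euc d}
    {gy : T → Euc d → Euc d' → Euc d'} {β μ : ℝ}
    (h : ∀ t, IsSaddleObjective X Y (H t) (gx t) (gy t) β μ)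
    (hH : ∀ x ∈ X, ∀ y ∈ Y, Integrable (fun t => H t x y) ν)
    (hgx : ∀ x ∈ X, ∀ y ∈ Y, Integrable (fun t => gx t x y) ν)
    (hgy : ∀ x ∈ X, ∀ y ∈ Y, Integrable (fun t => gy t x y) ν) :
    IsSaddleObjective X Y (fun x y => ∫ t, H t x y ∂ν) (fun x y => ∫ t, gx t x y ∂ν)
      (fun x y => ∫ t, gy t x y ∂ν) β μ := by
  have hb : ∀ {E : Type} [NormedAddCommGroup E] [NormedSpace ℝ E] (u : T → E) (C : ℝ),
      (∀ t, ‖u t‖ ≤ C) → ‖∫ t, u t ∂ν‖ ≤ C := by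
    intro E _ _ u C hu
    simpa using norm_integral_le_of_norm_le_const (μ := ν) (Filter.Eventually.of_forall hu)
  have hin : ∀ {k : ℕ} (u : T → Euc k) (c : Euc k), Integrable u ν →
      ⟪∫ t, u t ∂ν, c⟫_ℝ = ∫ t, ⟪u t, c⟫_ℝ ∂ν := by
    intro k u c hu
    rw [real_inner_comm, ← integral_inner hu c]
    simp only [real_inner_comm]
  refine ⟨fun y hy x hx x' hx' => ?_, fun x hx y hy y' hy' => ?_, fun x hx y hy y' hy' => ?_,
    fun x₁ hx₁ x₂ hx₂ y₁ hy₁ y₂ hy₂ => ?_, fun x₁ hx₁ x₂ hx₂ y₁ hy₁ y₂ hy₂ => ?_⟩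
  · rw [hin _ _ (hgx x hx y hy), ← integral_sub (hH _ hx' _ hy) (hH _ hx _ hy),
      ← integral_sub (f := fun t => H t x' y - H t x y) ((hH _ hx' _ hy).sub (hH _ hx _ hy))
        ((hgx x hx y hy).inner_const _)]
    rw [← Real.norm_eq_abs]
    exact hb _ _ fun t => (Real.norm_eq_abs _).trans_le <| (h t).taylor_x y hy x hx x' hx'
  · rw [hin _ _ (hgy x hx y hy), ← integral_sub (hH _ hx _ hy') (hH _ hx _ hy),
      ← integral_sub (f := fun t => H t x y' - H t x y) ((hH _ hx _ hy').sub (hH _ hx _ hy))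
        ((hgy x hx y hy).inner_const _)]
    rw [← Real.norm_eq_abs]
    exact hb _ _ fun t => (Real.norm_eq_abs _).trans_le <| (h t).taylor_y x hx y hy y' hy'
  · have h1 : ∫ t, H t x y' ∂ν ≤ ∫ t, (H t x y + ⟪gy t x y, y' - y⟫_ℝ
        - μ / 2 * ‖y' - y‖ ^ 2) ∂ν :=
      integral_mono (hH _ hx _ hy') (((hH _ hx _ hy).add ((hgy x hx y hy).inner_const _)).sub
        (integrable_const _)) fun t => (h t).concave_y x hx y hy y' hy'
    rw [integral_sub (f := fun t => H t x y + ⟪gy t x y, y' - y⟫_ℝ)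
        ((hH _ hx _ hy).add ((hgy x hx y hy).inner_const _)) (integrable_const _),
      integral_add (hH _ hx _ hy) ((hgy x hx y hy).inner_const _)] at h1
    rw [hin _ _ (hgy x hx y hy)]
    simpa using h1
  · rw [← integral_sub (hgx _ hx₁ _ hy₁) (hgx _ hx₂ _ hy₂)]
    exact hb _ _ fun t => (h t).lip_x x₁ hx₁ x₂ hx₂ y₁ hy₁ y₂ hy₂
  · rw [← integral_sub (hgy _ hx₁ _ hy₁) (hgy _ hx₂ _ hy₂)]
    exact hb _ _ fun t => (h t).lip_y x₁ hx₁ x₂ hx₂ y₁ hy₁ y₂ hy₂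

/-- A maximizer of `g` over `Y`, if there is one. -/
def maximizer (Y : Set (Euc d')) (g : Euc d' → ℝ) : Euc d' :=
  Classical.epsilon fun y => y ∈ Y ∧ IsMaxOn g Y y

namespace IsSaddleObjective

variable {X : Set (Euc d)} {Y : Set (Euc d')} {H : Euc d → Euc d' → ℝ}
  {gx : Euc d → Euc d' → Euc d} {gy : Euc d → Euc d' → Euc d'} {β μ : ℝ}

theorem maximizer_spec (h : IsSaddleObjective X Y H gx gy β μ) (hY : IsCompact Y)
    (hne : Y.Nonempty) {x : Euc d} (hx : x ∈ X) :
    maximizer Y (H x) ∈ Y ∧ IsMaxOn (H x) Y (maximizer Y (H x)) := by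
  obtain ⟨y, hy, hmax⟩ := hY.exists_isMaxOn hne (continuousOn_of_abs_sub_le (h.taylor_y x hx))
  exact Classical.epsilon_spec (p := fun y => y ∈ Y ∧ IsMaxOn (H x) Y y) ⟨y, hy, hmax⟩

theorem primal_eq {x : Euc d} {y : Euc d'} (hy : y ∈ Y) (hmax : IsMaxOn (H x) Y y) :
    primal Y H x = H x y := by
  refine le_antisymm (csSup_le ⟨_, y, hy, rfl⟩ ?_) (le_csSup ⟨H x y, ?_⟩ ⟨y, hy, rfl⟩)
  · rintro _ ⟨y', hy', rfl⟩; exact isMaxOn_iff.1 hmax y' hy'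
  · rintro _ ⟨y', hy', rfl⟩; exact isMaxOn_iff.1 hmax y' hy'

theorem le_sub_of_isMaxOn (h : IsSaddleObjective X Y H gx gy β μ) (hY : Convex ℝ Y)
    {x : Euc d} (hx : x ∈ X) {y : Euc d'} (hy : y ∈ Y) (hmax : IsMaxOn (H x) Y y)
    {y' : Euc d'} (hy' : y' ∈ Y) : H x y' ≤ H x y - μ / 2 * ‖y' - y‖ ^ 2 := by
  have h1 := h.concave_y x hx y hy y' hy'
  have h2 := inner_le_zero_of_isMaxOn hY hy (h.taylor_y x hx y hy) hmax hy'
  linarith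

/-- Stability of maximizers: the maximizers of two objectives are close if the `y`-gradients are. -/
theorem norm_sub_le_of_isMaxOn (h : IsSaddleObjective X Y H gx gy β μ) (hY : Convex ℝ Y)
    (hμ : 0 < μ) {H₂ : Euc d → Euc d' → ℝ} {gx₂ : Euc d → Euc d' → Euc d}
    {gy₂ : Euc d → Euc d' → Euc d'} (h₂ : IsSaddleObjective X Y H₂ gx₂ gy₂ β μ)
    {x₁ x₂ : Euc d} (hx₁ : x₁ ∈ X) (hx₂ : x₂ ∈ X) {y₁ y₂ : Euc d'} (hy₁ : y₁ ∈ Y) (hy₂ : y₂ ∈ Y)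
    (hmax₁ : IsMaxOn (H x₁) Y y₁) (hmax₂ : IsMaxOn (H₂ x₂) Y y₂) :
    ‖y₁ - y₂‖ ≤ ‖gy x₁ y₂ - gy₂ x₂ y₂‖ / μ := by
  -- Adding `h1` and `h2` gives `μ ‖y₁ - y₂‖² ≤ ⟪gy x₁ y₂, y₁ - y₂⟫`; subtracting the optimality
  -- condition `h3` at `y₂` leaves only a difference of gradients at that point.
  have h1 := h.le_sub_of_isMaxOn hY hx₁ hy₁ hmax₁ hy₂
  have h2 := h.concave_y x₁ hx₁ y₂ hy₂ y₁ hy₁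
  have h3 := inner_le_zero_of_isMaxOn hY hy₂ (h₂.taylor_y x₂ hx₂ y₂ hy₂) hmax₂ hy₁
  have h4 := real_inner_le_norm (gy x₁ y₂ - gy₂ x₂ y₂) (y₁ - y₂)
  rw [inner_sub_left] at h4
  rw [norm_sub_rev] at h1
  rw [le_div_iff₀ hμ]
  rcases (norm_nonneg (y₁ - y₂)).eq_or_lt with h0 | h0
  · rw [← h0]; simp
  · have : (‖y₁ - y₂‖ * μ) * ‖y₁ - y₂‖ ≤ ‖gy x₁ y₂ - gy₂ x₂ y₂‖ * ‖y₁ - y₂‖ := by nlinarith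
    exact le_of_mul_le_mul_right this h0

theorem norm_maximizer_sub_le (h : IsSaddleObjective X Y H gx gy β μ) (hY : Convex ℝ Y)
    (hYc : IsCompact Y) (hne : Y.Nonempty) (hμ : 0 < μ) {x₁ x₂ : Euc d} (hx₁ : x₁ ∈ X)
    (hx₂ : x₂ ∈ X) : ‖maximizer Y (H x₁) - maximizer Y (H x₂)‖ ≤ β / μ * ‖x₁ - x₂‖ := by
  obtain ⟨m1, m1'⟩ := h.maximizer_spec hYc hne hx₁
  obtain ⟨m2, m2'⟩ := h.maximizer_spec hYc hne hx₂
  refine (h.norm_sub_le_of_isMaxOn hY hμ h hx₁ hx₂ m1 m2 m1' m2').trans ?_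
  have := h.lip_y x₁ hx₁ x₂ hx₂ _ m2 _ m2
  rw [sub_self, norm_zero, add_zero] at this
  rw [div_mul_eq_mul_div]
  gcongr

/-- Danskin's theorem with a quadratic remainder. -/
theorem abs_primal_sub_le (h : IsSaddleObjective X Y H gx gy β μ) (hY : Convex ℝ Y)
    (hYc : IsCompact Y) (hne : Y.Nonempty) (hβ : 0 < β) (hμ : 0 < μ) {x x' : Euc d} (hx : x ∈ X)
    (hx' : x' ∈ X) :
    |primal Y H x' - primal Y H x - ⟪gx x (maximizer Y (H x)), x' - x⟫_ℝ|
      ≤ β * (1 + β / μ) * ‖x' - x‖ ^ 2 := by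
  obtain ⟨m, hm⟩ := h.maximizer_spec hYc hne hx
  obtain ⟨m', hm'⟩ := h.maximizer_spec hYc hne hx'
  rw [primal_eq m hm, primal_eq m' hm']
  have hl := h.norm_maximizer_sub_le hY hYc hne hμ hx' hx
  set y := maximizer Y (H x)
  set y' := maximizer Y (H x')
  -- The lower bound tests the value at `x'` with the old maximizer `y`. The upper bound tests the
  -- value at `x` with the new one `y'`; the gradient is then taken at `y'`, and Lipschitz
  -- maximizers make that error quadratic.
  have h1 := (abs_le.1 (h.taylor_x y m x hx x' hx')).1
  have h2 := (abs_le.1 (h.taylor_x y' m' x hx x' hx')).2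
  have h3 := isMaxOn_iff.1 hm' y m
  have h4 := isMaxOn_iff.1 hm y' m'
  have h5 := real_inner_le_norm (gx x y' - gx x y) (x' - x)
  have h6 : ‖gx x y' - gx x y‖ ≤ β * (β / μ * ‖x' - x‖) := by
    have := h.lip_x x hx x hx y' m' y m
    rw [sub_self, norm_zero, zero_add] at this
    exact this.trans (by gcongr)
  have h7 : ‖gx x y' - gx x y‖ * ‖x' - x‖ ≤ β * (β / μ * ‖x' - x‖) * ‖x' - x‖ := by gcongr
  rw [inner_sub_left] at h5
  have h8 : 0 ≤ β * (β / μ * ‖x' - x‖) * ‖x' - x‖ := by positivity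
  rw [abs_le]
  constructor <;> nlinarith

theorem gradientWithin_primal (h : IsSaddleObjective X Y H gx gy β μ) (hY : Convex ℝ Y)
    (hYc : IsCompact Y) (hne : Y.Nonempty) (hβ : 0 < β) (hμ : 0 < μ) (hX : Convex ℝ X)
    (hXi : (interior X).Nonempty) {x : Euc d} (hx : x ∈ X) :
    gradientWithin (primal Y H) X x = gx x (maximizer Y (H x)) :=
  gradientWithin_eq_of_abs_sub_le hX hXi hx
    fun _ hx' => h.abs_primal_sub_le hY hYc hne hβ hμ hx hx'

theorem continuousOn_primal (h : IsSaddleObjective X Y H gx gy β μ) (hY : Convex ℝ Y)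
    (hYc : IsCompact Y) (hne : Y.Nonempty) (hβ : 0 < β) (hμ : 0 < μ) :
    ContinuousOn (primal Y H) X :=
  continuousOn_of_abs_sub_le fun _ hx _ hx' => h.abs_primal_sub_le hY hYc hne hβ hμ hx hx'

end IsSaddleObjective

/-! ### Quadratic growth from the Polyak–Łojasiewicz inequality. -/

section QuadraticGrowth

variable {E : Type*} [NormedAddCommGroup E] [InnerProductSpace ℝ E]

/-- Ekeland-type argument: under a Polyak–Łojasiewicz inequality, `√(Φ - Φ(xs))` grows at least
linearly near an interior minimizer. -/
theorem norm_sub_le_sqrt_of_polyakLojasiewicz {X : Set E} (hX : IsCompact X) {Φ : E → ℝ}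
    {v : E → E} {K μ r : ℝ} (hK : 0 < K) (hμ : 0 < μ) {xs : E} (hxs : xs ∈ X)
    (hball : Metric.ball xs r ⊆ X)
    (htaylor : ∀ x ∈ X, ∀ y ∈ X, |Φ y - Φ x - ⟪v x, y - x⟫_ℝ| ≤ K * ‖y - x‖ ^ 2)
    (hcont : ContinuousOn Φ X)
    (hpl : ∀ x ∈ X, Φ x - Φ xs ≤ 1 / (2 * μ) * ‖v x‖ ^ 2)
    (hmin : ∀ x ∈ X, x ≠ xs → Φ xs < Φ x) {x₀ : E} (hx₀ : x₀ ∈ X)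
    (hr : 2 * ‖x₀ - xs‖ ≤ r) :
    √(2 * μ) / 4 * ‖x₀ - xs‖ ≤ √(Φ x₀ - Φ xs) := by
  by_contra! hlt
  set m := √(2 * μ) with hm
  have hmpos : 0 < m := by positivity
  set ψ : E → ℝ := fun x => √(Φ x - Φ xs) with hψ
  -- PL says that `ψ = √(Φ - Φ xs)` has slope at least `m / 2` wherever it is positive. If `ψ x₀`
  -- were below `m / 4 * ‖x₀ - xs‖`, the minimizer `p` of the perturbed function would lie closer to
  -- `x₀` than `xs` does, hence differ from `xs` and be interior, while minimality allows slope at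
  -- most `m / 4` there.
  have hψc : ContinuousOn (fun u => ψ u + m / 4 * ‖u - x₀‖) X := by
    have h1 : ContinuousOn ψ X := (hcont.sub continuousOn_const).sqrt
    exact h1.add (by fun_prop)
  obtain ⟨p, hpX, hpmin⟩ := hX.exists_isMinOn ⟨x₀, hx₀⟩ hψc
  have hp0 := isMinOn_iff.1 hpmin x₀ hx₀
  have hψ0 : 0 ≤ ψ p := Real.sqrt_nonneg _
  have hψx₀ : ψ x₀ < m / 4 * ‖x₀ - xs‖ := hlt
  simp only [sub_self, norm_zero, mul_zero, add_zero] at hp0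
  have hpd : ‖p - x₀‖ < ‖x₀ - xs‖ := by
    have : m / 4 * ‖p - x₀‖ < m / 4 * ‖x₀ - xs‖ := by linarith
    exact lt_of_mul_lt_mul_left this (by positivity)
  have hpxs : p ≠ xs := by
    rintro rfl
    rw [norm_sub_rev] at hpd
    exact lt_irrefl _ hpd
  have hpball : p ∈ Metric.ball xs r := by
    rw [Metric.mem_ball, dist_eq_norm]
    have := norm_sub_le_norm_sub_add_norm_sub p x₀ xs
    linarith
  have hgap : 0 < Φ p - Φ xs := sub_pos.2 (hmin p hpX hpxs)
  have hψp : 0 < ψ p := Real.sqrt_pos.2 hgap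
  have hψsq : ψ p ^ 2 = Φ p - Φ xs := Real.sq_sqrt hgap.le
  set g := v p with hg
  have hmg : m * ψ p ≤ ‖g‖ := by
    have h1 := hpl p hpX
    rw [← hψsq, div_mul_eq_mul_div, one_mul, le_div_iff₀ (by positivity)] at h1
    have h2 : (m * ψ p) ^ 2 ≤ ‖g‖ ^ 2 := by
      rw [mul_pow, hm, Real.sq_sqrt (by positivity)]; linarith
    exact (le_abs_self _).trans (abs_le_of_sq_le_sq h2 (norm_nonneg _))
  have hgpos : 0 < ‖g‖ := (by positivity : 0 < m * ψ p).trans_le hmg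
  -- A short gradient step from `p` exhibits the contradiction: it stays in the ball, `t < 1 / (4K)`
  -- makes the Taylor remainder less than a quarter of the decrease, and the third condition keeps
  -- the lower bound for `ψ` positive so that it can be squared.
  have hev : ∀ᶠ t : ℝ in 𝓝[>] 0, p - t • g ∈ Metric.ball xs r ∧ t < 1 / (4 * K) ∧
      m / 4 * (t * ‖g‖) < ψ p ∧ 0 < t := by
    have h1 : Filter.Tendsto (fun t : ℝ => p - t • g) (𝓝 0) (𝓝 (p - (0 : ℝ) • g)) :=
      (by fun_prop : Continuous fun t : ℝ => p - t • g).tendsto 0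
    have h2 : Filter.Tendsto (fun t : ℝ => m / 4 * (t * ‖g‖)) (𝓝 0) (𝓝 (m / 4 * (0 * ‖g‖))) :=
      (by fun_prop : Continuous fun t : ℝ => m / 4 * (t * ‖g‖)).tendsto 0
    rw [zero_smul, sub_zero] at h1
    rw [zero_mul, mul_zero] at h2
    refine .and (nhdsWithin_le_nhds (h1.eventually (Metric.isOpen_ball.mem_nhds hpball)))
      (.and (nhdsWithin_le_nhds (eventually_lt_nhds (by positivity)))
      (.and (nhdsWithin_le_nhds (h2.eventually (eventually_lt_nhds hψp)))
        self_mem_nhdsWithin))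
  obtain ⟨t, htb, htK, htψ, ht0⟩ := hev.exists
  have hu := hball htb
  have hmin' := isMinOn_iff.1 hpmin _ hu
  have htri : ‖p - t • g - x₀‖ ≤ ‖p - x₀‖ + t * ‖g‖ := by
    have h1 : p - t • g - x₀ = (p - x₀) - t • g := by abel
    rw [h1]
    refine (norm_sub_le _ _).trans ?_
    rw [norm_smul, Real.norm_of_nonneg ht0.le]
  have hψu : ψ p - m / 4 * (t * ‖g‖) ≤ ψ (p - t • g) := by
    have : m / 4 * ‖p - t • g - x₀‖ ≤ m / 4 * (‖p - x₀‖ + t * ‖g‖) := by gcongr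
    linarith
  have hgapu : 0 ≤ Φ (p - t • g) - Φ xs := by
    by_cases h : p - t • g = xs
    · rw [h, sub_self]
    · exact (sub_pos.2 (hmin _ hu h)).le
  have hsq : (ψ p - m / 4 * (t * ‖g‖)) ^ 2 ≤ Φ (p - t • g) - Φ xs := by
    rw [← Real.sq_sqrt hgapu]
    exact pow_le_pow_left₀ (by linarith) hψu 2
  have htay := (abs_le.1 (htaylor p hpX _ hu)).2
  rw [sub_sub_cancel_left, inner_neg_right, inner_smul_right, real_inner_self_eq_norm_sq, norm_neg,
    norm_smul, Real.norm_of_nonneg ht0.le] at htay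
  have h1 : t * ‖g‖ ^ 2 ≤ K * (t * ‖g‖) ^ 2 + m / 2 * ψ p * (t * ‖g‖) := by
    nlinarith [sq_nonneg (m / 4 * (t * ‖g‖))]
  have h2 : K * t < 1 / 4 := by
    rw [lt_div_iff₀ (by positivity)] at htK; linarith
  have h3 : m / 2 * ψ p * (t * ‖g‖) ≤ ‖g‖ / 2 * (t * ‖g‖) := by
    have : m / 2 * ψ p ≤ ‖g‖ / 2 := by linarith
    gcongr
  have h4 : K * (t * ‖g‖) ^ 2 < 1 / 4 * (t * ‖g‖ ^ 2) := by
    have : 0 < t * ‖g‖ ^ 2 := by positivity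
    nlinarith
  have : 0 < t * ‖g‖ ^ 2 := by positivity
  nlinarith

/-- A Polyak–Łojasiewicz function on a compact set with a unique minimizer, in the interior, has
quadratic growth. -/
theorem exists_quadratic_growth {X : Set E} (hX : IsCompact X) {Φ : E → ℝ}
    {v : E → E} {K μ : ℝ} (hK : 0 < K) (hμ : 0 < μ) {xs : E} (hxs : xs ∈ interior X)
    (htaylor : ∀ x ∈ X, ∀ y ∈ X, |Φ y - Φ x - ⟪v x, y - x⟫_ℝ| ≤ K * ‖y - x‖ ^ 2)
    (hcont : ContinuousOn Φ X)
    (hpl : ∀ x ∈ X, Φ x - Φ xs ≤ 1 / (2 * μ) * ‖v x‖ ^ 2)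
    (hmin : ∀ x ∈ X, x ≠ xs → Φ xs < Φ x) :
    ∃ c : ℝ, 0 < c ∧ ∀ x ∈ X, ‖x - xs‖ ^ 2 ≤ c * (Φ x - Φ xs) := by
  obtain ⟨r, hr, hball⟩ := Metric.isOpen_iff.1 isOpen_interior xs hxs
  have hball' := hball.trans interior_subset
  have hxsX := interior_subset hxs
  have hnn : ∀ x ∈ X, 0 ≤ Φ x - Φ xs := fun x hx => by
    by_cases h : x = xs
    · rw [h, sub_self]
    · exact (sub_pos.2 (hmin _ hx h)).le
  obtain ⟨D, hD⟩ := hX.isBounded.subset_closedBall xs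
  have hDn : ∀ x ∈ X, ‖x - xs‖ ≤ D := fun x hx => by
    simpa [dist_eq_norm] using hD hx
  -- Squaring the linear growth of the root gives `2μ / 16`, hence the factor `8 / μ`. Away from
  -- `xs`, compactness and uniqueness bound the gap below by a positive number.
  have hnear : ∀ x ∈ X, ‖x - xs‖ < r / 2 → ‖x - xs‖ ^ 2 ≤ 8 / μ * (Φ x - Φ xs) := by
    intro x hx hlt
    have h1 := norm_sub_le_sqrt_of_polyakLojasiewicz hX hK hμ hxsX hball' htaylor hcont hpl hmin hx
      (by linarith)
    have h2 := pow_le_pow_left₀ (by positivity) h1 2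
    rw [Real.sq_sqrt (hnn x hx), mul_pow, div_pow, Real.sq_sqrt (by positivity)] at h2
    rw [div_mul_eq_mul_div, le_div_iff₀ hμ]
    linarith
  have hfar : ∃ c : ℝ, 0 < c ∧ ∀ x ∈ X, r / 2 ≤ ‖x - xs‖ → ‖x - xs‖ ^ 2 ≤ c * (Φ x - Φ xs) := by
    have hcl : IsClosed {x : E | r / 2 ≤ ‖x - xs‖} :=
      isClosed_le continuous_const (by fun_prop)
    rcases (X ∩ {x : E | r / 2 ≤ ‖x - xs‖}).eq_empty_or_nonempty with he | hne
    · refine ⟨1, one_pos, fun x hx hrx => ?_⟩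
      exact absurd (show x ∈ X ∩ {x : E | r / 2 ≤ ‖x - xs‖} from ⟨hx, hrx⟩) (by simp [he])
    · obtain ⟨q, ⟨hqX, hqr⟩, hq⟩ := (hX.inter_right hcl).exists_isMinOn hne
        (hcont.mono Set.inter_subset_left)
      have hqr' : r / 2 ≤ ‖q - xs‖ := hqr
      have hqgap : 0 < Φ q - Φ xs := sub_pos.2 (hmin q hqX (by
        rintro rfl
        rw [sub_self, norm_zero] at hqr'
        linarith))
      have hDpos : 0 < D := by linarith [hDn q hqX]
      refine ⟨D ^ 2 / (Φ q - Φ xs), by positivity, fun x hx hrx => ?_⟩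
      have h1 := isMinOn_iff.1 hq x ⟨hx, hrx⟩
      calc ‖x - xs‖ ^ 2 ≤ D ^ 2 := by gcongr; exact hDn x hx
        _ = D ^ 2 / (Φ q - Φ xs) * (Φ q - Φ xs) := by field_simp
        _ ≤ D ^ 2 / (Φ q - Φ xs) * (Φ x - Φ xs) := by gcongr
  obtain ⟨c, hc, hfar⟩ := hfar
  refine ⟨max (8 / μ) c, lt_max_of_lt_right hc, fun x hx => ?_⟩
  rcases lt_or_ge ‖x - xs‖ (r / 2) with h | h
  · exact (hnear x hx h).trans (mul_le_mul_of_nonneg_right (le_max_left _ _) (hnn x hx))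
  · exact (hfar x hx h).trans (mul_le_mul_of_nonneg_right (le_max_right _ _) (hnn x hx))

end QuadraticGrowth

/-! ### Measurability of random evaluations and of maximizers. -/

section Measurability

variable {Ω : Type*} [MeasurableSpace Ω]

/-- Evaluating a Carathéodory function at a measurable random point is measurable. -/
theorem measurable_comp_of_continuousOn_of_measurable {A B : Type*} [TopologicalSpace A]
    [TopologicalSpace.MetrizableSpace A] [SecondCountableTopology A] [MeasurableSpace A]
    [OpensMeasurableSpace A] [TopologicalSpace B] [TopologicalSpace.PseudoMetrizableSpace B]
    [MeasurableSpace B] [BorelSpace B] {s : Set A} {u : A → Ω → B}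
    (hc : ∀ ω, ContinuousOn (fun a => u a ω) s) (hm : ∀ a ∈ s, Measurable (u a))
    {a : Ω → A} (ha : Measurable a) (has : ∀ ω, a ω ∈ s) :
    Measurable fun ω => u (a ω) ω := by
  have h := measurable_uncurry_of_continuous_of_measurable (ι := s)
    (u := fun p ω => u p ω) (fun ω => (hc ω).domRestrict) (fun p => hm p p.2)
  exact h.comp ((ha.subtype_mk (h := has)).prodMk measurable_id)

/-- The unique maximizer over a compact set of a Carathéodory function is measurable. -/
theorem measurable_of_isMaxOn_unique {B : Type*} [PseudoMetricSpace B]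
    [SecondCountableTopology B] [MeasurableSpace B] [BorelSpace B] {Y : Set B}
    (hY : IsCompact Y) {G : Ω → B → ℝ} (hm : ∀ y ∈ Y, Measurable fun ω => G ω y)
    (hc : ∀ ω, ContinuousOn (G ω) Y) {yhat : Ω → B} (hy : ∀ ω, yhat ω ∈ Y)
    (hmax : ∀ ω, IsMaxOn (G ω) Y (yhat ω))
    (huniq : ∀ ω, ∀ y ∈ Y, G ω (yhat ω) ≤ G ω y → y = yhat ω) : Measurable yhat := by
  refine measurable_of_isClosed fun C hC => ?_
  rcases (Y ∩ C).eq_empty_or_nonempty with he | hne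
  · convert MeasurableSet.empty
    ext ω
    simp only [Set.mem_preimage, Set.mem_empty_iff_false, iff_false]
    intro h
    exact (he ▸ (⟨hy ω, h⟩ : yhat ω ∈ Y ∩ C) : yhat ω ∈ (∅ : Set B))
  have : Nonempty ↑(Y ∩ C) := hne.to_subtype
  have : Nonempty Y := (hne.mono Set.inter_subset_left).to_subtype
  let p : ℕ → ↑(Y ∩ C) := TopologicalSpace.denseSeq _
  let q : ℕ → Y := TopologicalSpace.denseSeq _
  -- By uniqueness, the maximizer lies in `C` exactly when the maximum over `Y ∩ C` reaches the one
  -- over `Y`. Dense sequences and tolerances `1 / (m + 1)` express this by countably many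
  -- conditions.
  have heq : yhat ⁻¹' C = ⋂ m : ℕ, ⋃ i : ℕ, ⋂ j : ℕ,
      {ω | G ω (q j) ≤ G ω (p i) + 1 / ((m : ℝ) + 1)} := by
    ext ω
    simp only [Set.mem_preimage, Set.mem_iInter, Set.mem_iUnion, Set.mem_ofPred_eq]
    constructor
    · intro hω m
      have hcont : Continuous fun y : ↑(Y ∩ C) => G ω y :=
        ((hc ω).mono Set.inter_subset_left).domRestrict
      have hop : IsOpen {y : ↑(Y ∩ C) | G ω (yhat ω) < G ω y + 1 / ((m : ℝ) + 1)} :=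
        isOpen_lt continuous_const (hcont.add continuous_const)
      obtain ⟨i, hi⟩ := (TopologicalSpace.denseRange_denseSeq ↑(Y ∩ C)).exists_mem_open hop
        ⟨⟨yhat ω, hy ω, hω⟩, by
          have : (0 : ℝ) < 1 / ((m : ℝ) + 1) := by positivity
          simpa using Nat.cast_add_one_pos m⟩
      exact ⟨i, fun j => (isMaxOn_iff.1 (hmax ω) _ (q j).2).trans (le_of_lt hi)⟩
    · intro hω
      obtain ⟨c, hcK, hcmax⟩ := (hY.inter_right hC).exists_isMaxOn hne
        ((hc ω).mono Set.inter_subset_left)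
      have hcy : G ω (yhat ω) ≤ G ω c := by
        refine le_of_forall_pos_le_add fun ε hε => ?_
        obtain ⟨m, hm⟩ := exists_nat_one_div_lt hε
        obtain ⟨i, hi⟩ := hω m
        have hcl : IsClosed {y : Y | G ω y ≤ G ω (p i) + 1 / ((m : ℝ) + 1)} :=
          isClosed_le (hc ω).domRestrict continuous_const
        have hall : ∀ y : Y, G ω y ≤ G ω (p i) + 1 / ((m : ℝ) + 1) := fun y =>
          (TopologicalSpace.denseRange_denseSeq Y).induction_on
            (p := fun y => G ω y ≤ G ω (p i) + 1 / ((m : ℝ) + 1)) y hcl hi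
        have h1 := hall ⟨yhat ω, hy ω⟩
        have h2 := isMaxOn_iff.1 hcmax _ (p i).2
        simp only at h1
        linarith
      exact huniq ω c hcK.1 hcy ▸ hcK.2
  rw [heq]
  exact MeasurableSet.iInter fun m => MeasurableSet.iUnion fun i => MeasurableSet.iInter fun j =>
    measurableSet_le (hm _ (q j).2) ((hm _ (p i).2.1).add_const _)

end Measurability

/-! ### Second moments and Hoeffding bounds for empirical means. -/

section Concentration

/-- The empirical mean `(1/n) ∑ᵢ g(zᵢ)`. -/
def sampleMean {Z : Type*} {n : ℕ} {E : Type*} [AddCommGroup E] [Module ℝ E] (S : Fin n → Z) (g : Z → E) : E :=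
  (1 / (n : ℝ)) • ∑ i, g (S i)

theorem sampleMean_apply {Z : Type*} {n k : ℕ} (S : Fin n → Z) (g : Z → Euc k) (j : Fin k) :
    sampleMean S g j = sampleMean S fun z => g z j := by
  simp [sampleMean]


variable {Ω Z : Type*} [MeasurableSpace Ω] [MeasurableSpace Z] {n : ℕ}

/-- An i.i.d. sample from `P`. -/
structure IsIIDSample (Q : Measure Ω) (P : Measure Z) (S : Fin n → Ω → Z) : Prop where
  measurable : ∀ i, Measurable (S i)
  map_eq : ∀ i, Q.map (S i) = P
  indep : iIndepFun S Q

namespace IsIIDSample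

variable {Q : Measure Ω} {P : Measure Z} {S : Fin n → Ω → Z}

theorem measurePreserving (h : IsIIDSample Q P S) (i : Fin n) : MeasurePreserving (S i) Q P :=
  ⟨h.measurable i, h.map_eq i⟩

theorem aestronglyMeasurable {E : Type*} [TopologicalSpace E] (h : IsIIDSample Q P S) {g : Z → E}
    (hg : AEStronglyMeasurable g P) (i : Fin n) :
    AEStronglyMeasurable (fun ω => g (S i ω)) Q :=
  hg.comp_measurePreserving (h.measurePreserving i)

theorem integral_comp {E : Type*} [NormedAddCommGroup E] [NormedSpace ℝ E]
    (h : IsIIDSample Q P S) {g : Z → E}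
    (hg : AEStronglyMeasurable g P) (i : Fin n) : ∫ ω, g (S i ω) ∂Q = ∫ z, g z ∂P := by
  rw [← h.map_eq i] at hg ⊢
  exact (integral_map (h.measurable i).aemeasurable hg).symm

theorem iIndepFun_comp (h : IsIIDSample Q P S) {g : Z → ℝ} (hg : AEStronglyMeasurable g P) :
    iIndepFun (fun i ω => g (S i ω)) Q :=
  h.indep.comp₀ (fun _ => g) (fun i => (h.measurable i).aemeasurable) fun i => by
    rw [h.map_eq i]; exact hg.aemeasurable

theorem integral_sq_sampleMean_sub_le [IsProbabilityMeasure P] [IsProbabilityMeasure Q]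
    (h : IsIIDSample Q P S) (hn : 1 ≤ n) {g : Z → ℝ} (hg : MemLp g 2 P) :
    Integrable (fun ω => (sampleMean (fun i => S i ω) g - ∫ z, g z ∂P) ^ 2) Q ∧
    ∫ ω, (sampleMean (fun i => S i ω) g - ∫ z, g z ∂P) ^ 2 ∂Q ≤ (∫ z, g z ^ 2 ∂P) / n := by
  have hn0 : (0 : ℝ) < n := by exact_mod_cast hn
  have hL : ∀ i, MemLp (fun ω => g (S i ω)) 2 Q := fun i =>
    hg.comp_measurePreserving (h.measurePreserving i)
  set W : Ω → ℝ := fun ω => ∑ i, g (S i ω) with hW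
  have hWL : MemLp W 2 Q := memLp_finsetSum _ fun i _ => hL i
  have hWm : ∫ ω, W ω ∂Q = n * ∫ z, g z ∂P := by
    rw [hW, integral_finsetSum _ fun i _ => (hL i).integrable one_le_two]
    simp [h.integral_comp hg.1]
  have hfun : ∀ ω, (sampleMean (fun i => S i ω) g - ∫ z, g z ∂P) ^ 2
      = (1 / (n : ℝ) ^ 2) * (W ω - ∫ ω, W ω ∂Q) ^ 2 := by
    intro ω
    rw [hWm, sampleMean, smul_eq_mul]
    field_simp
    simp only [hW]
  have hint : Integrable (fun ω => (W ω - ∫ ω, W ω ∂Q) ^ 2) Q :=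
    (hWL.sub (memLp_const _)).integrable_sq
  simp_rw [hfun]
  refine ⟨hint.const_mul _, ?_⟩
  rw [integral_const_mul, ← variance_eq_integral hWL.1.aemeasurable]
  have hvar : variance W Q = ∑ i : Fin n, variance (fun ω => g (S i ω)) Q := by
    have := IndepFun.variance_sum (X := fun i ω => g (S i ω)) (s := Finset.univ) (μ := Q)
      (fun i _ => hL i) fun i _ j _ hij => (h.iIndepFun_comp hg.1).indepFun hij
    rw [← this]
    congr 1
    ext ω
    simp [hW]
  have hvi : ∀ i, variance (fun ω => g (S i ω)) Q ≤ ∫ z, g z ^ 2 ∂P := by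
    intro i
    refine (variance_le_expectation_sq (hL i).1).trans_eq ?_
    exact h.integral_comp (g := fun z => g z ^ 2) (hg.1.pow 2) i
  calc 1 / (n : ℝ) ^ 2 * variance W Q ≤ 1 / (n : ℝ) ^ 2 * ∑ _i : Fin n, ∫ z, g z ^ 2 ∂P := by
        rw [hvar]; gcongr with i; exact hvi i
    _ = (∫ z, g z ^ 2 ∂P) / n := by
        simp only [Finset.sum_const, Finset.card_univ, Fintype.card_fin, nsmul_eq_mul]
        field_simp

theorem integral_euc_apply {k : ℕ} {g : Z → Euc k} (hg : Integrable g P) (j : Fin k) :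
    (∫ z, g z ∂P) j = ∫ z, g z j ∂P :=
  ((EuclideanSpace.proj (𝕜 := ℝ) j).integral_comp_comm hg).symm

/-- Both sides are sums over coordinates of the scalar case, so no dimension factor appears. -/
theorem integral_norm_sq_sampleMean_sub_le [IsProbabilityMeasure P] [IsProbabilityMeasure Q]
    (h : IsIIDSample Q P S) (hn : 1 ≤ n) {k : ℕ} {g : Z → Euc k} (hg : MemLp g 2 P) :
    Integrable (fun ω => ‖sampleMean (fun i => S i ω) g - ∫ z, g z ∂P‖ ^ 2) Q ∧
    ∫ ω, ‖sampleMean (fun i => S i ω) g - ∫ z, g z ∂P‖ ^ 2 ∂Q ≤ (∫ z, ‖g z‖ ^ 2 ∂P) / n := by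
  have hgj : ∀ j, MemLp (fun z => g z j) 2 P := fun j =>
    (EuclideanSpace.proj (𝕜 := ℝ) j).comp_memLp' hg
  have key := fun j => h.integral_sq_sampleMean_sub_le hn (hgj j)
  have hfun : ∀ ω, ‖sampleMean (fun i => S i ω) g - ∫ z, g z ∂P‖ ^ 2
      = ∑ j, (sampleMean (fun i => S i ω) (fun z => g z j) - ∫ z, g z j ∂P) ^ 2 := by
    intro ω
    rw [EuclideanSpace.real_norm_sq_eq]
    simp only [PiLp.sub_apply, sampleMean_apply, integral_euc_apply (hg.integrable one_le_two)]
  simp_rw [hfun, EuclideanSpace.real_norm_sq_eq]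
  refine ⟨integrable_finsetSum _ fun j _ => (key j).1, ?_⟩
  rw [integral_finsetSum _ fun j _ => (key j).1,
    integral_finsetSum _ fun j _ => (hgj j).integrable_sq, Finset.sum_div]
  exact Finset.sum_le_sum fun j _ => (key j).2

theorem measureReal_sampleMean_sub_ge_le [IsProbabilityMeasure P] [IsProbabilityMeasure Q]
    (h : IsIIDSample Q P S) (hn : 1 ≤ n) {g : Z → ℝ} (hg : AEStronglyMeasurable g P) {b t : ℝ}
    (hb : 0 ≤ b) (hgb : ∀ z, |g z| ≤ b) (ht : 0 ≤ t) :
    Q.real {ω | t ≤ sampleMean (fun i => S i ω) g - ∫ z, g z ∂P}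
      ≤ Real.exp (-(n * t ^ 2) / (2 * b ^ 2)) := by
  have hn0 : (0 : ℝ) < n := by exact_mod_cast hn
  have hsub : ∀ i ∈ (Finset.univ : Finset (Fin n)),
      HasSubgaussianMGF (fun ω => g (S i ω) - ∫ z, g z ∂P) ((‖b - (-b)‖₊ / 2) ^ 2) Q := by
    intro i _
    have := hasSubgaussianMGF_of_mem_Icc (μ := Q) (X := fun ω => g (S i ω)) (a := -b) (b := b)
      (h.aestronglyMeasurable hg i).aemeasurable
      (Filter.Eventually.of_forall fun ω => abs_le.1 (hgb (S i ω)))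
    rwa [h.integral_comp hg i] at this
  have hind : iIndepFun (fun i ω => g (S i ω) - ∫ z, g z ∂P) Q :=
    h.iIndepFun_comp (g := fun z => g z - ∫ z, g z ∂P) (hg.sub aestronglyMeasurable_const)
  have key := HasSubgaussianMGF.measure_sum_ge_le_of_iIndepFun hind hsub
    (ε := n * t) (by positivity)
  have hset : {ω | t ≤ sampleMean (fun i => S i ω) g - ∫ z, g z ∂P}
      = {ω | n * t ≤ ∑ i, (g (S i ω) - ∫ z, g z ∂P)} := by
    ext ω
    simp only [Set.mem_ofPred_eq, sampleMean, smul_eq_mul, Finset.sum_sub_distrib,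
      Finset.sum_const, Finset.card_univ, Fintype.card_fin, nsmul_eq_mul]
    rw [← mul_le_mul_iff_right₀ hn0]
    have : (n : ℝ) * (1 / n * ∑ i, g (S i ω) - ∫ z, g z ∂P)
        = ∑ i, g (S i ω) - n * ∫ z, g z ∂P := by field_simp
    rw [this]
  rw [hset]
  refine key.trans_eq ?_
  congr 1
  have hbb : ‖b - -b‖ = 2 * b := by
    rw [sub_neg_eq_add, Real.norm_of_nonneg (by positivity)]; ring
  simp only [Finset.sum_const, Finset.card_univ, Fintype.card_fin, nsmul_eq_mul, NNReal.coe_mul,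
    NNReal.coe_natCast, NNReal.coe_pow, NNReal.coe_div, coe_nnnorm, NNReal.coe_ofNat, hbb]
  rcases hb.eq_or_lt with rfl | hb
  · simp
  · field_simp

theorem measureReal_abs_sampleMean_sub_ge_le [IsProbabilityMeasure P] [IsProbabilityMeasure Q]
    (h : IsIIDSample Q P S) (hn : 1 ≤ n) {g : Z → ℝ} (hg : AEStronglyMeasurable g P) {b t : ℝ}
    (hb : 0 ≤ b) (hgb : ∀ z, |g z| ≤ b) (ht : 0 ≤ t) :
    Q.real {ω | t ≤ |sampleMean (fun i => S i ω) g - ∫ z, g z ∂P|}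
      ≤ 2 * Real.exp (-(n * t ^ 2) / (2 * b ^ 2)) := by
  have h1 := h.measureReal_sampleMean_sub_ge_le hn hg hb hgb ht
  have h2 := h.measureReal_sampleMean_sub_ge_le hn (g := fun z => -g z) hg.neg hb
    (fun z => by simpa using hgb z) ht
  have hsub : {ω | t ≤ |sampleMean (fun i => S i ω) g - ∫ z, g z ∂P|}
      ⊆ {ω | t ≤ sampleMean (fun i => S i ω) g - ∫ z, g z ∂P}
        ∪ {ω | t ≤ sampleMean (fun i => S i ω) (fun z => -g z) - ∫ z, -g z ∂P} := by
    intro ω hω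
    rcases le_abs.1 (Set.mem_ofPred_eq ▸ hω : t ≤ |_|) with hω | hω
    · exact Or.inl hω
    · right
      simp only [Set.mem_ofPred_eq, sampleMean, Finset.sum_neg_distrib, smul_neg, integral_neg]
      simp only [sampleMean] at hω
      linarith
  calc _ ≤ _ := measureReal_mono hsub
    _ ≤ _ := measureReal_union_le _ _
    _ ≤ _ := by linarith

/-- Hoeffding's inequality for bounded random vectors, coordinate by coordinate. -/
theorem measureReal_lt_norm_sampleMean_sub_le [IsProbabilityMeasure P] [IsProbabilityMeasure Q]
    (h : IsIIDSample Q P S) (hn : 1 ≤ n) {k : ℕ} {g : Z → Euc k} (hg : AEStronglyMeasurable g P)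
    {b t : ℝ} (hb : 0 ≤ b) (hgb : ∀ z, ‖g z‖ ≤ b) (ht : 0 ≤ t) :
    Q.real {ω | t < ‖sampleMean (fun i => S i ω) g - ∫ z, g z ∂P‖}
      ≤ k * (2 * Real.exp (-(n * t ^ 2) / (2 * k * b ^ 2))) := by
  have hgi : Integrable g P := .of_bound hg b (Filter.Eventually.of_forall hgb)
  have hgj : ∀ j, AEStronglyMeasurable (fun z => g z j) P := fun j =>
    (EuclideanSpace.proj (𝕜 := ℝ) j).continuous.comp_aestronglyMeasurable hg
  -- If every coordinate is below `t / √k`, the norm is at most `t`; hence a union bound over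
  -- coordinates at this level.
  have key := fun j : Fin k => h.measureReal_abs_sampleMean_sub_ge_le hn (hgj j) hb
    (fun z => (PiLp.norm_apply_le (g z) j).trans (hgb z)) (t := t / √k) (by positivity)
  have hsub : {ω | t < ‖sampleMean (fun i => S i ω) g - ∫ z, g z ∂P‖}
      ⊆ ⋃ j : Fin k,
        {ω | t / √k ≤ |sampleMean (fun i => S i ω) (fun z => g z j) - ∫ z, g z j ∂P|} := by
    intro ω hω
    by_contra hcon
    simp only [Set.mem_iUnion, Set.mem_ofPred_eq, not_exists, not_le] at hcon
    have hω' : t < ‖sampleMean (fun i => S i ω) g - ∫ z, g z ∂P‖ := hω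
    have h1 : ‖sampleMean (fun i => S i ω) g - ∫ z, g z ∂P‖ ^ 2 ≤ t ^ 2 := by
      rw [EuclideanSpace.real_norm_sq_eq]
      simp only [PiLp.sub_apply, sampleMean_apply, integral_euc_apply hgi]
      calc _ ≤ ∑ _j : Fin k, (t / √k) ^ 2 := by
            refine Finset.sum_le_sum fun j _ => ?_
            rw [← sq_abs]
            exact pow_le_pow_left₀ (abs_nonneg _) (hcon j).le 2
        _ ≤ t ^ 2 := by
            rw [Finset.sum_const, Finset.card_univ, Fintype.card_fin, nsmul_eq_mul, div_pow,
              Real.sq_sqrt (by positivity)]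
            rcases Nat.eq_zero_or_pos k with rfl | hk
            · simpa using sq_nonneg t
            · have : (0 : ℝ) < k := by exact_mod_cast hk
              exact le_of_eq (by field_simp)
    exact absurd (abs_le_of_sq_le_sq h1 ht) (by rw [abs_norm]; exact not_le.2 hω')
  calc _ ≤ _ := measureReal_mono hsub
    _ ≤ ∑ j : Fin k, _ := measureReal_iUnion_fintype_le _
    _ ≤ ∑ _j : Fin k, 2 * Real.exp (-(n * (t / √k) ^ 2) / (2 * b ^ 2)) :=
        Finset.sum_le_sum fun j _ => key j
    _ = _ := by
        rw [Finset.sum_const, Finset.card_univ, Fintype.card_fin, nsmul_eq_mul, div_pow,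
          Real.sq_sqrt (by positivity)]
        congr 3
        rw [mul_div_assoc', ← neg_div, div_div]
        congr 1
        ring

end IsIIDSample

end Concentration

/-! ### Nets and the localized uniform deviation. -/

section UniformDeviation

/-- A bounded subset of `ℝᵈ` has a `1/m`-net with at most `(c m)ᵈ` points. -/
theorem exists_finset_net {d : ℕ} {X : Set (Euc d)} {xs : Euc d} {D : ℝ}
    (hD : ∀ x ∈ X, ‖x - xs‖ ≤ D) {m : ℕ} (hm : 1 ≤ m) :
    ∃ N : Finset (Euc d), (∀ p ∈ N, p ∈ X) ∧
      (N.card : ℝ) ≤ (((2 * ⌈D⌉₊ * (d + 1) + 1 : ℕ) : ℝ) * m) ^ d ∧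
      ∀ x ∈ X, ∃ p ∈ N, ‖x - p‖ ≤ 1 / m := by
  classical
  have hm0 : (0 : ℝ) < m := by exact_mod_cast hm
  set M : ℕ := ⌈D⌉₊ * (m * (d + 1)) with hM
  -- Cubes of side `1 / (m (d + 1))`: two points of one cube are within `√d / (m (d + 1)) ≤ 1 / m`.
  -- Using `d + 1` instead of `√d` keeps the count an integer and covers `d = 0`. Representatives
  -- are picked inside `X`, one for each occupied cube.
  let cell : Euc d → Fin d → ℤ := fun x j => ⌊(x j - xs j) * (m * (d + 1))⌋
  let T : Finset (Fin d → ℤ) := Fintype.piFinset fun _ => Finset.Icc (-(M : ℤ)) M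
  have hcell : ∀ x ∈ X, cell x ∈ T := by
    intro x hx
    rw [Fintype.mem_piFinset]
    intro j
    have h1 : |x j - xs j| ≤ ⌈D⌉₊ :=
      (PiLp.norm_apply_le (x - xs) j).trans ((hD x hx).trans (Nat.le_ceil D))
    have h2 : |(x j - xs j) * (m * (d + 1))| ≤ (M : ℝ) := by
      rw [abs_mul, abs_of_pos (by positivity : (0 : ℝ) < m * (d + 1)), hM]
      push_cast
      gcongr
    rw [Finset.mem_Icc]
    constructor
    · refine Int.le_floor.2 ?_
      push_cast
      exact (abs_le.1 h2).1
    · have h3 := (Int.floor_le ((x j - xs j) * (m * (d + 1)))).trans (abs_le.1 h2).2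
      exact Int.cast_le.1 (h3.trans_eq (Int.cast_natCast M).symm)
  let rep : (Fin d → ℤ) → Euc d := fun c => Classical.epsilon fun x => x ∈ X ∧ cell x = c
  have hrep : ∀ x ∈ X, rep (cell x) ∈ X ∧ cell (rep (cell x)) = cell x := fun x hx =>
    Classical.epsilon_spec (p := fun u => u ∈ X ∧ cell u = cell x) ⟨x, hx, rfl⟩
  refine ⟨(T.filter fun c => ∃ x ∈ X, cell x = c).image rep, ?_, ?_, ?_⟩
  · intro p hp
    obtain ⟨c, hc, rfl⟩ := Finset.mem_image.1 hp
    obtain ⟨x, hx, rfl⟩ := (Finset.mem_filter.1 hc).2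
    exact (hrep x hx).1
  · have h1 : ((T.filter fun c => ∃ x ∈ X, cell x = c).image rep).card ≤ (2 * M + 1) ^ d := by
      refine Finset.card_image_le.trans ((Finset.card_filter_le _ _).trans ?_)
      simp only [T, Fintype.card_piFinset, Int.card_Icc, Finset.prod_const, Finset.card_univ,
        Fintype.card_fin]
      refine Nat.pow_le_pow_left ?_ d
      omega
    have h2 : 2 * M + 1 ≤ (2 * ⌈D⌉₊ * (d + 1) + 1) * m := by
      rw [hM]; nlinarith
    calc _ ≤ (((2 * M + 1) ^ d : ℕ) : ℝ) := by exact_mod_cast h1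
      _ ≤ ((((2 * ⌈D⌉₊ * (d + 1) + 1) * m) ^ d : ℕ) : ℝ) := by
          exact_mod_cast Nat.pow_le_pow_left h2 d
      _ = _ := by push_cast; ring
  · intro x hx
    obtain ⟨h1, h2⟩ := hrep x hx
    refine ⟨rep (cell x), Finset.mem_image_of_mem _
      (Finset.mem_filter.2 ⟨hcell x hx, x, hx, rfl⟩), ?_⟩
    set p := rep (cell x)
    have hj : ∀ j, |x j - p j| ≤ 1 / (m * (d + 1)) := by
      intro j
      have h3 := Int.abs_sub_lt_one_of_floor_eq_floor (congrFun h2 j)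
      rw [← sub_mul, abs_mul, abs_of_pos (by positivity : (0 : ℝ) < m * (d + 1)),
        sub_sub_sub_cancel_right, abs_sub_comm] at h3
      rw [le_div_iff₀ (by positivity)]
      exact h3.le
    have h4 : ‖x - p‖ ^ 2 ≤ (1 / (m : ℝ)) ^ 2 := by
      rw [EuclideanSpace.real_norm_sq_eq]
      calc _ ≤ ∑ _j : Fin d, (1 / ((m : ℝ) * (d + 1))) ^ 2 := by
            refine Finset.sum_le_sum fun j _ => ?_
            rw [← sq_abs]
            exact pow_le_pow_left₀ (abs_nonneg _) (hj j) 2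
        _ = d / (d + 1) ^ 2 * (1 / (m : ℝ)) ^ 2 := by
            simp only [Finset.sum_const, Finset.card_univ, Fintype.card_fin, nsmul_eq_mul]
            field_simp
        _ ≤ 1 * (1 / (m : ℝ)) ^ 2 := by
            gcongr
            rw [div_le_one (by positivity)]
            nlinarith [(Nat.cast_nonneg d : (0 : ℝ) ≤ d)]
        _ = _ := one_mul _
    exact abs_le_of_sq_le_sq h4 (by positivity) |> (abs_norm (x - p) ▸ ·)

/-- The constant in the tail bound `exists_uniform_deviation`. -/
def deviationConstant (d k : ℕ) (D L ε : ℝ) : ℝ :=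
  ((2 * ⌈D⌉₊ * (d + 1) + 1 : ℕ) : ℝ) ^ d * (k * 2)
    * ((d + 2).factorial / (ε ^ 2 / (2 * k * L ^ 2)) ^ (d + 2))

theorem deviationConstant_nonneg (d k : ℕ) (D L ε : ℝ) : 0 ≤ deviationConstant d k D L ε := by
  unfold deviationConstant; positivity

/-- One term of the exponential series, `(nc)^(d+2) / (d+2)! ≤ exp (nc)`: two powers beyond the
net's `n^d` leave `1 / n²`. -/
theorem pow_mul_exp_neg_le {c : ℝ} (hc : 0 < c) {n : ℕ} (hn : 1 ≤ n) (d : ℕ) :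
    (n : ℝ) ^ d * Real.exp (-(n * c)) ≤ (d + 2).factorial / c ^ (d + 2) / (n : ℝ) ^ 2 := by
  have hn0 : (0 : ℝ) < n := by exact_mod_cast hn
  have h1 := Real.pow_div_factorial_le_exp (n * c) (by positivity) (d + 2)
  rw [div_le_iff₀ (by positivity)] at h1
  rw [Real.exp_neg, le_div_iff₀ (by positivity), le_div_iff₀ (by positivity), ← div_eq_mul_inv,
    div_mul_eq_mul_div, div_mul_eq_mul_div, div_le_iff₀ (by positivity)]
  calc (n : ℝ) ^ d * n ^ 2 * c ^ (d + 2) = (n * c) ^ (d + 2) := by ring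
    _ ≤ _ := h1.trans_eq (mul_comm _ _)

variable {Ω Z : Type*} [MeasurableSpace Ω] [MeasurableSpace Z] {n : ℕ}

/-- Localized uniform deviation: up to an event of probability `O(1/n²)`, the centred empirical
means of a Lipschitz family vary by at most `ε ‖x - xs‖ + O(1/n)` over a bounded set. -/
theorem IsIIDSample.exists_uniform_deviation {Q : Measure Ω} [IsProbabilityMeasure Q]
    {P : Measure Z} [IsProbabilityMeasure P] {S : Fin n → Ω → Z} (hS : IsIIDSample Q P S)
    (hn : 1 ≤ n) {d k : ℕ} {X : Set (Euc d)} {xs : Euc d} (hxs : xs ∈ X) {D : ℝ}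
    (hD : ∀ x ∈ X, ‖x - xs‖ ≤ D) {L ε : ℝ} (hL : 0 < L) (hε : 0 < ε)
    {g : Euc d → Z → Euc k} (hg : ∀ x ∈ X, Integrable (g x) P)
    (hlip : ∀ z, ∀ x ∈ X, ∀ y ∈ X, ‖g x z - g y z‖ ≤ L * ‖x - y‖) :
    ∃ A : Set Ω, MeasurableSet A ∧ Q.real A ≤ deviationConstant d k D L ε / (n : ℝ) ^ 2 ∧
      ∀ ω ∉ A, ∀ x ∈ X,
        ‖(sampleMean (fun i => S i ω) (g x) - ∫ z, g x z ∂P)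
          - (sampleMean (fun i => S i ω) (g xs) - ∫ z, g xs z ∂P)‖
          ≤ ε * ‖x - xs‖ + (2 * L + ε) / n := by
  have hn0 : (0 : ℝ) < n := by exact_mod_cast hn
  obtain ⟨N, hNX, hNcard, hNnet⟩ := exists_finset_net hD hn
  let Δ : Euc d → Ω → Euc k := fun x ω => sampleMean (fun i => S i ω) (g x) - ∫ z, g x z ∂P
  have hΔ : ∀ x ∈ X, ∀ y ∈ X, ∀ ω, Δ x ω - Δ y ω
      = sampleMean (fun i => S i ω) (fun z => g x z - g y z) - ∫ z, (g x z - g y z) ∂P := by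
    intro x hx y hy ω
    rw [integral_sub (hg x hx) (hg y hy)]
    simp only [Δ, sampleMean, Finset.sum_sub_distrib, smul_sub]
    abel
  have hΔlip : ∀ x ∈ X, ∀ y ∈ X, ∀ ω, ‖Δ x ω - Δ y ω‖ ≤ 2 * L * ‖x - y‖ := by
    intro x hx y hy ω
    rw [hΔ x hx y hy]
    have h1 : ‖sampleMean (fun i => S i ω) (fun z => g x z - g y z)‖ ≤ L * ‖x - y‖ := by
      rw [sampleMean, norm_smul, Real.norm_of_nonneg (by positivity), div_mul_eq_mul_div, one_mul,
        div_le_iff₀ hn0]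
      refine (norm_sum_le _ _).trans ?_
      calc _ ≤ ∑ _i : Fin n, L * ‖x - y‖ := Finset.sum_le_sum fun i _ => hlip _ x hx y hy
        _ = _ := by
          rw [Finset.sum_const, Finset.card_univ, Fintype.card_fin, nsmul_eq_mul, mul_comm]
    have h2 : ‖∫ z, (g x z - g y z) ∂P‖ ≤ L * ‖x - y‖ := by
      simpa using norm_integral_le_of_norm_le_const (μ := P)
        (Filter.Eventually.of_forall fun z => hlip z x hx y hy)
    linarith [norm_sub_le (sampleMean (fun i => S i ω) (fun z => g x z - g y z))
      (∫ z, (g x z - g y z) ∂P)]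
  -- The threshold and the almost sure bound `L * ‖p - xs‖` on the increment both scale with `‖p -
  -- xs‖`, so the Hoeffding exponent is the same at all net points, however close to `xs`.
  let B : Euc d → Set Ω := fun p => {ω | ε * ‖p - xs‖ < ‖Δ p ω - Δ xs ω‖}
  set τ : ℝ := k * (2 * Real.exp (-(n * (ε ^ 2 / (2 * k * L ^ 2))))) with hτ
  have hB : ∀ p ∈ N, Q.real (B p) ≤ τ := by
    intro p hp
    by_cases h0 : p = xs
    · have : B p = ∅ := by
        ext ω
        simp [B, h0]
      rw [this, measureReal_empty]
      positivity
    · have hr : 0 < ‖p - xs‖ := norm_pos_iff.2 (sub_ne_zero.2 h0)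
      have h1 := hS.measureReal_lt_norm_sampleMean_sub_le hn (g := fun z => g p z - g xs z)
        ((hg p (hNX p hp)).sub (hg xs hxs)).1 (b := L * ‖p - xs‖) (t := ε * ‖p - xs‖)
        (by positivity) (fun z => hlip z p (hNX p hp) xs hxs) (by positivity)
      simp only [← hΔ p (hNX p hp) xs hxs] at h1
      refine h1.trans_eq ?_
      rw [hτ]
      congr 3
      field_simp
  let A : Set Ω := ⋃ p ∈ N, B p
  have hA : Q.real A ≤ deviationConstant d k D L ε / (n : ℝ) ^ 2 := by
    have h1 : Q.real A ≤ N.card * τ := by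
      calc Q.real A ≤ ∑ p ∈ N, Q.real (B p) := measureReal_biUnion_finset_le _ _
        _ ≤ ∑ _p ∈ N, τ := Finset.sum_le_sum hB
        _ = _ := by rw [Finset.sum_const, nsmul_eq_mul]
    rcases Nat.eq_zero_or_pos k with rfl | hk
    · refine h1.trans ?_
      simp [hτ, deviationConstant]
    · have hk0 : (0 : ℝ) < k := by exact_mod_cast hk
      have hc : 0 < ε ^ 2 / (2 * k * L ^ 2) := by positivity
      calc Q.real A ≤ N.card * τ := h1
        _ ≤ (((2 * ⌈D⌉₊ * (d + 1) + 1 : ℕ) : ℝ) * n) ^ d * τ := by gcongr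
        _ = ((2 * ⌈D⌉₊ * (d + 1) + 1 : ℕ) : ℝ) ^ d * (k * 2)
            * ((n : ℝ) ^ d * Real.exp (-(n * (ε ^ 2 / (2 * k * L ^ 2))))) := by
            rw [hτ, mul_pow]; ring
        _ ≤ ((2 * ⌈D⌉₊ * (d + 1) + 1 : ℕ) : ℝ) ^ d * (k * 2)
            * ((d + 2).factorial / (ε ^ 2 / (2 * k * L ^ 2)) ^ (d + 2) / (n : ℝ) ^ 2) := by
            gcongr
            exact pow_mul_exp_neg_le hc hn d
        _ = _ := by rw [deviationConstant, mul_div_assoc]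
  -- The family is measurable in `z` only up to null sets, so the exceptional event is replaced by a
  -- measurable hull of equal measure.
  refine ⟨toMeasurable Q A, measurableSet_toMeasurable _ _, ?_, fun ω hω x hx => ?_⟩
  · rwa [measureReal_def, measure_toMeasurable, ← measureReal_def]
  · obtain ⟨p, hp, hxp⟩ := hNnet x hx
    have hωp : ω ∉ B p := fun h => hω (subset_toMeasurable Q A (Set.mem_biUnion hp h))
    have h1 : ‖Δ p ω - Δ xs ω‖ ≤ ε * ‖p - xs‖ := not_lt.1 hωp
    have h2 := hΔlip x hx p (hNX p hp) ω
    have h3 : ‖Δ x ω - Δ xs ω‖ ≤ ‖Δ x ω - Δ p ω‖ + ‖Δ p ω - Δ xs ω‖ :=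
      norm_sub_le_norm_sub_add_norm_sub _ _ _
    have h4 : ‖p - xs‖ ≤ 1 / n + ‖x - xs‖ := by
      have := norm_sub_le_norm_sub_add_norm_sub p x xs
      rw [norm_sub_rev p x] at this
      linarith
    calc ‖Δ x ω - Δ xs ω‖ ≤ 2 * L * (1 / n) + ε * (1 / n + ‖x - xs‖) := by
          refine h3.trans (add_le_add (h2.trans ?_) (h1.trans ?_)) <;> gcongr
      _ = ε * ‖x - xs‖ + (2 * L + ε) / n := by ring

end UniformDeviation

/-! ### Comparing the primal functions of two objectives. -/

namespace IsSaddleObjective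

variable {X : Set (Euc d)} {Y : Set (Euc d')} {H : Euc d → Euc d' → ℝ}
  {gx : Euc d → Euc d' → Euc d} {gy : Euc d → Euc d' → Euc d'} {β μ : ℝ}

theorem congr (h : IsSaddleObjective X Y H gx gy β μ) {H' : Euc d → Euc d' → ℝ}
    (heq : ∀ x ∈ X, ∀ y ∈ Y, H' x y = H x y) : IsSaddleObjective X Y H' gx gy β μ where
  taylor_x y hy x hx x' hx' := by
    rw [heq x' hx' y hy, heq x hx y hy]; exact h.taylor_x y hy x hx x' hx'
  taylor_y x hx y hy y' hy' := by
    rw [heq x hx y' hy', heq x hx y hy]; exact h.taylor_y x hx y hy y' hy'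
  concave_y x hx y hy y' hy' := by
    rw [heq x hx y' hy', heq x hx y hy]; exact h.concave_y x hx y hy y' hy'
  lip_x := h.lip_x
  lip_y := h.lip_y

/-- The empirical mean is integration against the normalized counting measure on `Fin n`, so the
averaging lemma applies. -/
theorem sampleMean {Z : Type*} {n : ℕ} (hn : 1 ≤ n) (S : Fin n → Z)
    {f : Euc d → Euc d' → Z → ℝ} {gx : Euc d → Euc d' → Z → Euc d}
    {gy : Euc d → Euc d' → Z → Euc d'}
    (h : ∀ z, IsSaddleObjective X Y (fun x y => f x y z) (fun x y => gx x y z)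
      (fun x y => gy x y z) β μ) :
    IsSaddleObjective X Y (empiricalRisk f S) (fun x y => sampleMean S (gx x y))
      (fun x y => sampleMean S (gy x y)) β μ := by
  have hn0 : (n : ENNReal) ≠ 0 := by simpa using Nat.one_le_iff_ne_zero.1 hn
  let ν : Measure (Fin n) := (n : ENNReal)⁻¹ • Measure.count
  have : IsProbabilityMeasure ν := ⟨by
    simp only [ν, Measure.smul_apply, Measure.count_univ, smul_eq_mul, ENat.card_eq_coe_fintype_card,
      Fintype.card_fin]
    exact ENNReal.inv_mul_cancel hn0 (ENNReal.natCast_ne_top n)⟩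
  have hν : ∀ {E : Type} [NormedAddCommGroup E] [NormedSpace ℝ E] [CompleteSpace E] (u : Fin n → E),
      ∫ i, u i ∂ν = (1 / (n : ℝ)) • ∑ i, u i := by
    intro E _ _ _ u
    simp [ν, integral_smul_measure]
  have key := IsSaddleObjective.integral ν (fun i => h (S i)) (fun _ _ _ _ => .of_finite)
    (fun _ _ _ _ => .of_finite) fun _ _ _ _ => .of_finite
  simp only [hν] at key
  exact key

/-- The primal function inherits the Polyak–Łojasiewicz inequality. -/
theorem primal_sub_le (h : IsSaddleObjective X Y H gx gy β μ) (hXc : IsCompact X)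
    (hX : Convex ℝ X) (hXi : (interior X).Nonempty) (hYc : IsCompact Y) (hne : Y.Nonempty)
    {μx : ℝ} (hpl : IsPLX H X Y μx) {x x' : Euc d} (hx : x ∈ X) (hx' : x' ∈ X) :
    primal Y H x - primal Y H x' ≤ 1 / (2 * μx) * ‖gx x (maximizer Y (H x))‖ ^ 2 := by
  obtain ⟨m, hm⟩ := h.maximizer_spec hYc hne hx
  obtain ⟨m', hm'⟩ := h.maximizer_spec hYc hne hx'
  -- With `y` the maximizer at `x`, the value at `x` is `H x y`, and the value at `x'` is at least
  -- `H x' y`, hence at least the infimum in PL at this `y`.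
  have h1 := hpl _ m x hx
  rw [gradientWithin_eq_of_abs_sub_le hX hXi hx (h.taylor_x _ m x hx)] at h1
  have hbdd : BddBelow ((fun x' => H x' (maximizer Y (H x))) '' X) :=
    (hXc.image_of_continuousOn (continuousOn_of_abs_sub_le (h.taylor_x _ m))).bddBelow
  have h2 := csInf_le hbdd ⟨x', hx', rfl⟩
  have h3 := isMaxOn_iff.1 hm' _ m
  simp only at h2
  rw [primal_eq m hm, primal_eq m' hm']
  linarith

theorem eq_maximizer (h : IsSaddleObjective X Y H gx gy β μ) (hY : Convex ℝ Y) (hYc : IsCompact Y)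
    (hμ : 0 < μ) {x : Euc d} (hx : x ∈ X) {y : Euc d'} (hy : y ∈ Y)
    (hle : H x (maximizer Y (H x)) ≤ H x y) : y = maximizer Y (H x) := by
  obtain ⟨m, hm⟩ := h.maximizer_spec hYc ⟨y, hy⟩ hx
  have h1 := h.le_sub_of_isMaxOn hY hx m hm hy
  have h2 : ‖y - maximizer Y (H x)‖ ^ 2 ≤ 0 := by nlinarith
  have h3 : ‖y - maximizer Y (H x)‖ = 0 := by nlinarith [norm_nonneg (y - maximizer Y (H x))]
  exact sub_eq_zero.1 (norm_eq_zero.1 h3)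

/-- The gradients of two primal functions differ by the differences of the partial gradients. -/
theorem norm_gradient_primal_le (h : IsSaddleObjective X Y H gx gy β μ) (hY : Convex ℝ Y)
    (hYc : IsCompact Y) (hne : Y.Nonempty) (hβ : 0 < β) (hμ : 0 < μ)
    {H₂ : Euc d → Euc d' → ℝ} {gx₂ : Euc d → Euc d' → Euc d} {gy₂ : Euc d → Euc d' → Euc d'}
    (h₂ : IsSaddleObjective X Y H₂ gx₂ gy₂ β μ) {x : Euc d} (hx : x ∈ X) :
    ‖gx x (maximizer Y (H x))‖ ≤ ‖gx₂ x (maximizer Y (H₂ x))‖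
      + (‖gx₂ x (maximizer Y (H x)) - gx x (maximizer Y (H x))‖
        + β / μ * ‖gy₂ x (maximizer Y (H x)) - gy x (maximizer Y (H x))‖) := by
  obtain ⟨m, hm⟩ := h.maximizer_spec hYc hne hx
  obtain ⟨m₂, hm₂⟩ := h₂.maximizer_spec hYc hne hx
  -- The order of the two objectives matters: it places the `y`-gradient difference at the maximizer
  -- of `H`, which does not depend on the sample when `H` is the population risk.
  have h1 := h₂.norm_sub_le_of_isMaxOn hY hμ h hx hx m₂ m hm₂ hm
  set y := maximizer Y (H x)
  set y₂ := maximizer Y (H₂ x)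
  have h3 : ‖gx₂ x y₂ - gx₂ x y‖ ≤ β / μ * ‖gy₂ x y - gy x y‖ := by
    have := h₂.lip_x x hx x hx y₂ m₂ y m
    rw [sub_self, norm_zero, zero_add] at this
    calc _ ≤ β * (‖gy₂ x y - gy x y‖ / μ) := this.trans (by gcongr)
      _ = _ := by ring
  have h4 : gx x y = gx₂ x y₂ - (gx₂ x y₂ - gx₂ x y) - (gx₂ x y - gx x y) := by abel
  have h5 := norm_sub_le (gx₂ x y₂ - (gx₂ x y₂ - gx₂ x y)) (gx₂ x y - gx x y)
  have h6 := norm_sub_le (gx₂ x y₂) (gx₂ x y₂ - gx₂ x y)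
  rw [← h4] at h5
  linarith

end IsSaddleObjective

theorem norm_sampleMean_le {Z E : Type*} [NormedAddCommGroup E] [NormedSpace ℝ E] {n : ℕ}
    (S : Fin n → Z) (g : Z → E) : ‖sampleMean S g‖ ≤ ∑ i, ‖g (S i)‖ := by
  rw [sampleMean, norm_smul]
  refine (mul_le_of_le_one_left (norm_nonneg _) ?_).trans (norm_sum_le _ _)
  rw [Real.norm_of_nonneg (by positivity)]
  rcases Nat.eq_zero_or_pos n with rfl | hn
  · simp
  · exact div_le_one_of_le₀ (by exact_mod_cast hn) (by positivity)

/-! ### Integrability of gradients and of the empirical primal gradient. -/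

section Empirical

variable {Z : Type*} [MeasurableSpace Z] {P : Measure Z}
  {f : Euc d → Euc d' → Z → ℝ} {X : Set (Euc d)} {Y : Set (Euc d')} {β μ : ℝ}
  {Ω : Type*} [MeasurableSpace Ω] {Q : Measure Ω} {n : ℕ}
  {S : Fin n → Ω → Z}

/-- Square integrability at one point spreads to all of `X × Y`, since the gradients at two points
differ by a bounded function of `z`. -/
theorem memLp_two_gradX [IsProbabilityMeasure P] (hf : IsNCSC f X Y β μ) (hβ : 0 < β) (hr : IsRegularCost P f X Y)
    {xs : Euc d} {ys : Euc d'} (hxs : xs ∈ X) (hys : ys ∈ Y)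
    (h2 : Integrable (fun z => ‖gradX f xs ys z‖ ^ 2) P) {x : Euc d} {y : Euc d'} (hx : x ∈ X)
    (hy : y ∈ Y) : MemLp (gradX f x y) 2 P := by
  have h1 : MemLp (gradX f xs ys) 2 P :=
    (memLp_two_iff_integrable_sq_norm (hr.measurable_gradX xs hxs ys hys)).2 h2
  have h3 : MemLp (fun z => gradX f x y z - gradX f xs ys z) 2 P :=
    MemLp.of_bound ((hr.measurable_gradX x hx y hy).sub h1.1) (β * (‖x - xs‖ + ‖y - ys‖))
      (Filter.Eventually.of_forall fun z =>
        (hf.isSaddleObjective hβ z).lip_x x hx xs hxs y hy ys hys)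
  convert h3.add h1 using 1
  funext z
  simp

theorem memLp_two_gradY [IsProbabilityMeasure P] (hf : IsNCSC f X Y β μ) (hβ : 0 < β) (hr : IsRegularCost P f X Y)
    {xs : Euc d} {ys : Euc d'} (hxs : xs ∈ X) (hys : ys ∈ Y)
    (h2 : Integrable (fun z => ‖gradY f xs ys z‖ ^ 2) P) {x : Euc d} {y : Euc d'} (hx : x ∈ X)
    (hy : y ∈ Y) : MemLp (gradY f x y) 2 P := by
  have h1 : MemLp (gradY f xs ys) 2 P :=
    (memLp_two_iff_integrable_sq_norm (hr.measurable_gradY xs hxs ys hys)).2 h2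
  have h3 : MemLp (fun z => gradY f x y z - gradY f xs ys z) 2 P :=
    MemLp.of_bound ((hr.measurable_gradY x hx y hy).sub h1.1) (β * (‖x - xs‖ + ‖y - ys‖))
      (Filter.Eventually.of_forall fun z =>
        (hf.isSaddleObjective hβ z).lip_y x hx xs hxs y hy ys hys)
  convert h3.add h1 using 1
  funext z
  simp

/-- The empirical primal gradient at a random point is measurable up to null sets. -/
theorem aestronglyMeasurable_empirical_gradient (hf : IsNCSC f X Y β μ) (hβ : 0 < β) (hμ : 0 < μ)
    (hr : IsRegularCost P f X Y) (hne : Y.Nonempty) (hn : 1 ≤ n) (hS : IsIIDSample Q P S)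
    {xhat : Ω → Euc d} (hm : Measurable xhat) (hX : ∀ ω, xhat ω ∈ X) :
    AEStronglyMeasurable (fun ω => sampleMean (fun i => S i ω) (gradX f (xhat ω)
      (maximizer Y (empiricalRisk f (fun i => S i ω) (xhat ω))))) Q := by
  have hsad := fun ω => IsSaddleObjective.sampleMean hn (fun i => S i ω)
    (hf.isSaddleObjective hβ)
  have hm' : NullMeasurable xhat Q := hm.nullMeasurable
  have hFm : ∀ x ∈ X, ∀ y ∈ Y,
      NullMeasurable (fun ω => empiricalRisk f (fun i => S i ω) x y) Q := fun x hx y hy => by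
    refine AEMeasurable.nullMeasurable ?_
    simp only [empiricalRisk]
    exact (Finset.aemeasurable_fun_sum _ fun i _ =>
      (hS.aestronglyMeasurable (hr.integrable x hx y hy).1 i).aemeasurable).const_mul _
  have hgm : ∀ p ∈ X ×ˢ Y,
      NullMeasurable (fun ω => sampleMean (fun i => S i ω) (gradX f p.1 p.2)) Q := fun p hp => by
    refine AEMeasurable.nullMeasurable ?_
    simp only [sampleMean]
    exact (Finset.aemeasurable_fun_sum _ fun i _ =>
      (hS.aestronglyMeasurable (hr.measurable_gradX _ hp.1 _ hp.2) i).aemeasurable).const_smul (1 / (n : ℝ))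
  have hmaxm : NullMeasurable (fun ω => maximizer Y
      (empiricalRisk f (fun i => S i ω) (xhat ω))) Q := by
    -- Costs and gradients are only almost everywhere measurable in `z`, so the argument runs on the
    -- completed σ-algebra.
    refine measurable_of_isMaxOn_unique (Ω := NullMeasurableSpace Ω Q) hf.compact_Y
      (G := fun ω => empiricalRisk f (fun i => S i ω) (xhat ω)) (fun y hy => ?_)
      (fun ω => continuousOn_of_abs_sub_le ((hsad ω).taylor_y _ (hX ω)))
      (fun ω => ((hsad ω).maximizer_spec hf.compact_Y hne (hX ω)).1)
      (fun ω => ((hsad ω).maximizer_spec hf.compact_Y hne (hX ω)).2)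
      (fun ω y hy hle => (hsad ω).eq_maximizer hf.convex_Y hf.compact_Y hμ (hX ω) hy hle)
    exact measurable_comp_of_continuousOn_of_measurable (Ω := NullMeasurableSpace Ω Q) (s := X)
      (u := fun x ω => empiricalRisk f (fun i => S i ω) x y)
      (fun ω => continuousOn_of_abs_sub_le ((hsad ω).taylor_x y hy))
      (fun x hx => hFm x hx y hy) hm' hX
  have hfin : NullMeasurable (fun ω => sampleMean (fun i => S i ω) (gradX f (xhat ω)
      (maximizer Y (empiricalRisk f (fun i => S i ω) (xhat ω))))) Q := by
    refine measurable_comp_of_continuousOn_of_measurable (Ω := NullMeasurableSpace Ω Q)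
      (s := X ×ˢ Y) (u := fun p ω => sampleMean (fun i => S i ω) (gradX f p.1 p.2))
      (fun ω => ?_) hgm (a := fun ω => (xhat ω, maximizer Y
        (empiricalRisk f (fun i => S i ω) (xhat ω))))
      ((show Measurable (α := NullMeasurableSpace Ω Q) xhat from hm').prodMk hmaxm)
      (fun ω => ⟨hX ω, ((hsad ω).maximizer_spec hf.compact_Y hne (hX ω)).1⟩)
    intro p hp
    rw [ContinuousWithinAt, tendsto_iff_norm_sub_tendsto_zero]
    have hlim : Filter.Tendsto (fun q : Euc d × Euc d' => β * (‖q.1 - p.1‖ + ‖q.2 - p.2‖))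
        (𝓝[X ×ˢ Y] p) (𝓝 0) := by
      have : Continuous fun q : Euc d × Euc d' => β * (‖q.1 - p.1‖ + ‖q.2 - p.2‖) := by fun_prop
      have h := this.tendsto p
      simp only [sub_self, norm_zero, add_zero, mul_zero] at h
      exact h.mono_left nhdsWithin_le_nhds
    refine squeeze_zero' (Filter.Eventually.of_forall fun _ => norm_nonneg _) ?_ hlim
    filter_upwards [self_mem_nhdsWithin] with q hq
    exact (hsad ω).lip_x _ hq.1 _ hp.1 _ hq.2 _ hp.2
  exact hfin.aemeasurable.aestronglyMeasurable

/-- By the Lipschitz bound and compactness, the gradient at any random point is dominated by the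
sample gradients at `(xs, ys)` plus a constant. -/
theorem integrable_sq_empirical_gradient [IsProbabilityMeasure P] [IsProbabilityMeasure Q]
    (hf : IsNCSC f X Y β μ) (hβ : 0 < β) (hμ : 0 < μ)
    (hr : IsRegularCost P f X Y) (hn : 1 ≤ n) (hS : IsIIDSample Q P S)
    {xs : Euc d} {ys : Euc d'} (hxs : xs ∈ X) (hys : ys ∈ Y)
    (h2 : Integrable (fun z => ‖gradX f xs ys z‖ ^ 2) P)
    {xhat : Ω → Euc d} (hm : Measurable xhat) (hX : ∀ ω, xhat ω ∈ X) :
    Integrable (fun ω => ‖sampleMean (fun i => S i ω) (gradX f (xhat ω)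
      (maximizer Y (empiricalRisk f (fun i => S i ω) (xhat ω))))‖ ^ 2) Q := by
  have hne : Y.Nonempty := ⟨ys, hys⟩
  have hsad := fun ω => IsSaddleObjective.sampleMean hn (fun i => S i ω)
    (hf.isSaddleObjective hβ)
  have hmeas := aestronglyMeasurable_empirical_gradient hf hβ hμ hr hne hn hS hm hX
  obtain ⟨DX, hDX⟩ := hf.compact_X.isBounded.subset_closedBall xs
  obtain ⟨DY, hDY⟩ := hf.compact_Y.isBounded.subset_closedBall ys
  have h1 : MemLp (fun ω => (∑ i, ‖gradX f xs ys (S i ω)‖) + β * (DX + DY)) 2 Q := by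
    refine MemLp.add (memLp_finsetSum _ fun i _ => ?_) (memLp_const _)
    exact ((memLp_two_gradX hf hβ hr hxs hys h2 hxs hys).comp_measurePreserving
      (hS.measurePreserving i)).norm
  refine (memLp_two_iff_integrable_sq_norm hmeas).1 (h1.of_le hmeas
    (Filter.Eventually.of_forall fun ω => ?_))
  obtain ⟨m, -⟩ := (hsad ω).maximizer_spec hf.compact_Y hne (hX ω)
  have h3 := (hsad ω).lip_x _ (hX ω) xs hxs _ m ys hys
  have h4 := norm_sampleMean_le (fun i => S i ω) (gradX f xs ys)
  have h5 := hDX (hX ω)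
  have h6 := hDY m
  rw [mem_closedBall_iff_norm] at h5 h6
  have h7 : β * (‖xhat ω - xs‖ + ‖maximizer Y (empiricalRisk f (fun i => S i ω) (xhat ω)) - ys‖)
      ≤ β * (DX + DY) := by gcongr
  refine le_trans ?_ (Real.le_norm_self _)
  have h8 := norm_le_norm_add_norm_sub' (sampleMean (fun i => S i ω) (gradX f (xhat ω)
      (maximizer Y (empiricalRisk f (fun i => S i ω) (xhat ω)))))
      (sampleMean (fun i => S i ω) (gradX f xs ys))
  linarith

end Empirical

/-! ### Constants of the population problem. -/

section Population

variable {Z : Type*} [MeasurableSpace Z] {P : Measure Z} [IsProbabilityMeasure P]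
  {f : Euc d → Euc d' → Z → ℝ} {X : Set (Euc d)} {Y : Set (Euc d')} {F : Euc d → Euc d' → ℝ}
  {β μ : ℝ} {xs : Euc d} {ys : Euc d'}

theorem isSaddleObjective_population (hf : IsNCSC f X Y β μ) (hβ : 0 < β)
    (hr : IsRegularCost P f X Y) (hF : ∀ x ∈ X, ∀ y ∈ Y, F x y = populationRisk P f x y)
    (hxs : xs ∈ X) (hys : ys ∈ Y)
    (h2x : Integrable (fun z => ‖gradX f xs ys z‖ ^ 2) P)
    (h2y : Integrable (fun z => ‖gradY f xs ys z‖ ^ 2) P) :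
    IsSaddleObjective X Y F (fun x y => ∫ z, gradX f x y z ∂P)
      (fun x y => ∫ z, gradY f x y z ∂P) β μ :=
  (IsSaddleObjective.integral P (hf.isSaddleObjective hβ) hr.integrable
    (fun _ hx _ hy => (memLp_two_gradX hf hβ hr hxs hys h2x hx hy).integrable one_le_two)
    (fun _ hx _ hy => (memLp_two_gradY hf hβ hr hxs hys h2y hx hy).integrable one_le_two)).congr hF

/-- The constants of the population problem: quadratic growth of the primal function, and bounds
on `X` and on the primal gap. -/
def HasPopulationBounds (F : Euc d → Euc d' → ℝ) (X : Set (Euc d)) (Y : Set (Euc d'))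
    (xs : Euc d) (c D M : ℝ) : Prop :=
  0 < c ∧ 0 ≤ M ∧ (∀ x ∈ X, ‖x - xs‖ ^ 2 ≤ c * (primal Y F x - primal Y F xs)) ∧
    (∀ x ∈ X, ‖x - xs‖ ≤ D) ∧ ∀ x ∈ X, primal Y F x - primal Y F xs ≤ M

/-- The bounds themselves mention only `F`, `X`, `Y` and `xs`; this is what makes the final `1/n²`
constant independent of the cost. -/
theorem IsSaddleObjective.exists_hasPopulationBounds {gx : Euc d → Euc d' → Euc d}
    {gy : Euc d → Euc d' → Euc d'} (h : IsSaddleObjective X Y F gx gy β μ) (hβ : 0 < β)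
    (hμ : 0 < μ) (hXc : IsCompact X) (hX : Convex ℝ X) (hYc : IsCompact Y) (hY : Convex ℝ Y)
    {μx : ℝ} (hμx : 0 < μx) (hpl : IsPLX F X Y μx) (hsol : IsMinimaxSolution F X Y xs ys) :
    ∃ c D M : ℝ, HasPopulationBounds F X Y xs c D M := by
  have hxs := interior_subset hsol.mem_interior
  have hne : Y.Nonempty := ⟨ys, hsol.mem_Y⟩
  have hXi : (interior X).Nonempty := ⟨xs, hsol.mem_interior⟩
  have hcont := h.continuousOn_primal hY hYc hne hβ hμ
  obtain ⟨c, hc, hgrowth⟩ := exists_quadratic_growth (K := β * (1 + β / μ)) hXc (by positivity) hμx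
    hsol.mem_interior (fun x hx x' hx' => h.abs_primal_sub_le hY hYc hne hβ hμ hx hx') hcont
    (fun x hx => h.primal_sub_le hXc hX hXi hYc hne hpl hx hxs) hsol.lt_primal
  obtain ⟨D, hD⟩ := hXc.isBounded.subset_closedBall xs
  obtain ⟨p, hp, hpmax⟩ := hXc.exists_isMaxOn ⟨xs, hxs⟩ hcont
  refine ⟨c, D, primal Y F p - primal Y F xs, hc, sub_nonneg.2 (isMaxOn_iff.1 hpmax _ hxs),
    hgrowth, fun x hx => mem_closedBall_iff_norm.1 (hD hx), fun x hx => ?_⟩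
  exact sub_le_sub_right (isMaxOn_iff.1 hpmax _ hx) _

end Population

/-! ### Absorption and the excess risk bound in expectation. -/

/-- PL provides `2 μx G` on the left. The choice of `ε` makes the localized part `12 (1 + κ)² ε² r²`
at most `μx G`, so one of the two copies of `μx G` remains. -/
theorem gap_le_of_gradient_deviation {G g a u v u₀ v₀ r κ ε η c μx : ℝ} (hμx : 0 < μx)
    (hc : 0 < c) (hκ : 0 ≤ κ) (hg0 : 0 ≤ g) (hu0 : 0 ≤ u) (hv0 : 0 ≤ v)
    (hG : G ≤ 1 / (2 * μx) * g ^ 2) (hg : g ≤ a + (u + κ * v)) (hu : u ≤ u₀ + (ε * r + η))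
    (hv : v ≤ v₀ + (ε * r + η)) (hr : r ^ 2 ≤ c * G)
    (hε : ε ^ 2 = μx / (12 * (1 + κ) ^ 2 * c)) :
    G ≤ 2 / μx * a ^ 2 + 6 / μx * u₀ ^ 2 + 6 * κ ^ 2 / μx * v₀ ^ 2
      + 12 * (1 + κ) ^ 2 / μx * η ^ 2 := by
  have h1 : 2 * μx * G ≤ g ^ 2 := by
    rw [div_mul_eq_mul_div, one_mul, le_div_iff₀ (by positivity)] at hG
    linarith
  have h2 : g ^ 2 ≤ 2 * a ^ 2 + 2 * (u + κ * v) ^ 2 := by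
    have := pow_le_pow_left₀ hg0 hg 2
    nlinarith [sq_nonneg (a - (u + κ * v))]
  have h3 : (u + κ * v) ^ 2 ≤ 3 * u₀ ^ 2 + 3 * (κ * v₀) ^ 2
      + 3 * ((1 + κ) * (ε * r + η)) ^ 2 := by
    have h4 : u + κ * v ≤ u₀ + κ * v₀ + (1 + κ) * (ε * r + η) := by nlinarith
    have := pow_le_pow_left₀ (by positivity) h4 2
    nlinarith [sq_nonneg (u₀ - κ * v₀), sq_nonneg (u₀ - (1 + κ) * (ε * r + η)),
      sq_nonneg (κ * v₀ - (1 + κ) * (ε * r + η))]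
  have h5 : (ε * r + η) ^ 2 ≤ 2 * (ε ^ 2 * r ^ 2) + 2 * η ^ 2 := by
    nlinarith [sq_nonneg (ε * r - η)]
  have h6 : 12 * (1 + κ) ^ 2 * (ε ^ 2 * r ^ 2) ≤ μx * G := by
    calc 12 * (1 + κ) ^ 2 * (ε ^ 2 * r ^ 2) ≤ 12 * (1 + κ) ^ 2 * (ε ^ 2 * (c * G)) := by gcongr
      _ = μx * G := by rw [hε]; field_simp
  have h7 : (1 + κ) ^ 2 * (ε * r + η) ^ 2
      ≤ (1 + κ) ^ 2 * (2 * (ε ^ 2 * r ^ 2) + 2 * η ^ 2) := by gcongr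
  have h8 : μx * G ≤ 2 * a ^ 2 + 6 * u₀ ^ 2 + 6 * κ ^ 2 * v₀ ^ 2 + 12 * (1 + κ) ^ 2 * η ^ 2 := by
    nlinarith
  have h9 : 2 / μx * a ^ 2 + 6 / μx * u₀ ^ 2 + 6 * κ ^ 2 / μx * v₀ ^ 2
      + 12 * (1 + κ) ^ 2 / μx * η ^ 2
      = (2 * a ^ 2 + 6 * u₀ ^ 2 + 6 * κ ^ 2 * v₀ ^ 2 + 12 * (1 + κ) ^ 2 * η ^ 2) / μx := by
    field_simp
  rw [h9, le_div_iff₀ hμx]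
  linarith

/-- Deviation scale at which the localized error is absorbed by quadratic growth. -/
def deviationScale (μx κ c : ℝ) : ℝ := √(μx / (12 * (1 + κ) ^ 2 * c))

/-- The constant of the `1/n²` term. -/
def remainderConstant (d d' : ℕ) (β μx μy c D M : ℝ) : ℝ :=
  12 * (1 + β / μy) ^ 2 / μx
      * (2 * (β * (1 + β / μy)) + deviationScale μx (β / μy) c) ^ 2
    + M * (deviationConstant d d D (β * (1 + β / μy)) (deviationScale μx (β / μy) c)
      + deviationConstant d d' D (β * (1 + β / μy)) (deviationScale μx (β / μy) c)) + 1

/-- The last summand `1` of the constant provides strictness; the other summands may vanish. -/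
theorem remainderConstant_pos {β μx μy c D M : ℝ} (hμx : 0 < μx) (hM : 0 ≤ M) :
    0 < remainderConstant d d' β μx μy c D M := by
  have h1 := deviationConstant_nonneg d d D (β * (1 + β / μy)) (deviationScale μx (β / μy) c)
  have h2 := deviationConstant_nonneg d d' D (β * (1 + β / μy)) (deviationScale μx (β / μy) c)
  unfold remainderConstant
  positivity

section ExcessRisk

variable {Z : Type*} [MeasurableSpace Z] {P : Measure Z} [IsProbabilityMeasure P]
  {f : Euc d → Euc d' → Z → ℝ} {X : Set (Euc d)} {Y : Set (Euc d')} {F : Euc d → Euc d' → ℝ}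
  {β μx μy : ℝ} {xs : Euc d} {ys : Euc d'}
  {Ω : Type*} [MeasurableSpace Ω] {Q : Measure Ω} [IsProbabilityMeasure Q] {n : ℕ}
  {S : Fin n → Ω → Z}

theorem integral_primal_gap_le (hβ : 0 < β) (hμx : 0 < μx) (hμy : 0 < μy) (hpl : IsPLX F X Y μx)
    (hsol : IsMinimaxSolution F X Y xs ys) {c D M : ℝ} (hb : HasPopulationBounds F X Y xs c D M)
    (hf : IsNCSC f X Y β μy) (hr : IsRegularCost P f X Y)
    (hF : ∀ x ∈ X, ∀ y ∈ Y, F x y = populationRisk P f x y)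
    (h2x : Integrable (fun z => ‖gradX f xs ys z‖ ^ 2) P)
    (h2y : Integrable (fun z => ‖gradY f xs ys z‖ ^ 2) P)
    (hn : 1 ≤ n) (hS : IsIIDSample Q P S) {xhat : Ω → Euc d} (hm : Measurable xhat)
    (hX : ∀ ω, xhat ω ∈ X) :
    Integrable (fun ω => primal Y F (xhat ω) - primal Y F xs) Q ∧
      Integrable (fun ω =>
        ‖gradientWithin (primal Y (empiricalRisk f (fun i => S i ω))) X (xhat ω)‖ ^ 2) Q ∧
      ∫ ω, (primal Y F (xhat ω) - primal Y F xs) ∂Q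
        ≤ 8 * (∫ ω,
            ‖gradientWithin (primal Y (empiricalRisk f (fun i => S i ω))) X (xhat ω)‖ ^ 2 ∂Q) / μx
          + 6 * ((∫ z, ‖gradX f xs ys z‖ ^ 2 ∂P) / (μx * n)
              + β ^ 2 * (∫ z, ‖gradY f xs ys z‖ ^ 2 ∂P) / (μx * μy ^ 2 * n))
          + remainderConstant d d' β μx μy c D M / (n : ℝ) ^ 2 := by
  obtain ⟨hc, hM0, hgrowth, hD, hM⟩ := hb
  have hn0 : (0 : ℝ) < n := by exact_mod_cast hn
  have hxs := interior_subset hsol.mem_interior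
  have hys := hsol.mem_Y
  have hne : Y.Nonempty := ⟨ys, hys⟩
  have hXi : (interior X).Nonempty := ⟨xs, hsol.mem_interior⟩
  have hY := hf.convex_Y
  have hYc := hf.compact_Y
  have hpop := isSaddleObjective_population hf hβ hr hF hxs hys h2x h2y
  have hsad := fun ω => IsSaddleObjective.sampleMean hn (fun i => S i ω)
    (hf.isSaddleObjective hβ)
  have hgradS : ∀ ω, gradientWithin (primal Y (empiricalRisk f (fun i => S i ω))) X (xhat ω)
      = sampleMean (fun i => S i ω) (gradX f (xhat ω)
        (maximizer Y (empiricalRisk f (fun i => S i ω) (xhat ω)))) := fun ω =>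
    (hsad ω).gradientWithin_primal hY hYc hne hβ hμy hf.convex_X hXi (hX ω)
  have hintS := integrable_sq_empirical_gradient hf hβ hμy hr hn hS hxs hys h2x hm hX
  have hcont := hpop.continuousOn_primal hY hYc hne hβ hμy
  have hintΦ : Integrable (fun ω => primal Y F (xhat ω) - primal Y F xs) Q := by
    have hmeas : Measurable fun ω => primal Y F (xhat ω) :=
      measurable_comp_of_continuousOn_of_measurable (s := X) (u := fun x _ => primal Y F x)
        (fun _ => hcont) (fun _ _ => measurable_const) hm hX
    refine .of_bound (hmeas.sub_const _).aestronglyMeasurable M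
      (Filter.Eventually.of_forall fun ω => ?_)
    rw [Real.norm_eq_abs, abs_of_nonneg]
    · exact hM _ (hX ω)
    · by_cases h : xhat ω = xs
      · rw [h, sub_self]
      · exact (sub_pos.2 (hsol.lt_primal _ (hX ω) h)).le
  simp_rw [hgradS]
  refine ⟨hintΦ, hintS, ?_⟩
  set κ := β / μy with hκ
  have hκ0 : 0 < κ := by positivity
  set L := β * (1 + κ) with hL
  have hL0 : 0 < L := by positivity
  set ε := deviationScale μx κ c with hε
  have hε0 : 0 < ε := by rw [hε, deviationScale]; positivity
  have hεsq : ε ^ 2 = μx / (12 * (1 + κ) ^ 2 * c) := by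
    rw [hε, deviationScale, Real.sq_sqrt (by positivity)]
  -- Along the curve `x ↦ (x, ym x)` the gradients of `f` are `L`-Lipschitz with `L = β (1 + κ)`,
  -- and at `xs` the curve passes through `(xs, ys)`.
  let ym : Euc d → Euc d' := fun x => maximizer Y (F x)
  have hym : ∀ x ∈ X, ym x ∈ Y := fun x hx => (hpop.maximizer_spec hYc hne hx).1
  have hyms : ym xs = ys := (hpop.eq_maximizer hY hYc hμy hxs hys
    (isMaxOn_iff.1 hsol.isMaxOn _ (hym xs hxs))).symm
  have hymlip : ∀ x ∈ X, ∀ y ∈ X, β * (‖x - y‖ + ‖ym x - ym y‖) ≤ L * ‖x - y‖ :=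
    fun x hx y hy => by
      have := hpop.norm_maximizer_sub_le hY hYc hne hμy hx hy
      calc β * (‖x - y‖ + ‖ym x - ym y‖) ≤ β * (‖x - y‖ + κ * ‖x - y‖) := by gcongr
        _ = L * ‖x - y‖ := by rw [hL]; ring
  have hLx : ∀ x ∈ X, ∀ y ∈ Y, MemLp (gradX f x y) 2 P := fun x hx y hy =>
    memLp_two_gradX hf hβ hr hxs hys h2x hx hy
  have hLy : ∀ x ∈ X, ∀ y ∈ Y, MemLp (gradY f x y) 2 P := fun x hx y hy =>
    memLp_two_gradY hf hβ hr hxs hys h2y hx hy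
  obtain ⟨Ax, hAxm, hAx, hdevx⟩ := hS.exists_uniform_deviation hn hxs hD hL0 hε0
    (g := fun x => gradX f x (ym x))
    (fun x hx => (hLx x hx _ (hym x hx)).integrable one_le_two)
    (fun z x hx y hy => ((hf.isSaddleObjective hβ z).lip_x x hx y hy _ (hym x hx) _
      (hym y hy)).trans (hymlip x hx y hy))
  obtain ⟨Ay, hAym, hAy, hdevy⟩ := hS.exists_uniform_deviation hn hxs hD hL0 hε0
    (g := fun x => gradY f x (ym x))
    (fun x hx => (hLy x hx _ (hym x hx)).integrable one_le_two)
    (fun z x hx y hy => ((hf.isSaddleObjective hβ z).lip_y x hx y hy _ (hym x hx) _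
      (hym y hy)).trans (hymlip x hx y hy))
  simp only [hyms] at hdevx hdevy
  obtain ⟨hu_int, hu_le⟩ := hS.integral_norm_sq_sampleMean_sub_le hn (hLx xs hxs ys hys)
  obtain ⟨hv_int, hv_le⟩ := hS.integral_norm_sq_sampleMean_sub_le hn (hLy xs hxs ys hys)
  set G : Ω → ℝ := fun ω => primal Y F (xhat ω) - primal Y F xs with hG
  set a : Ω → ℝ := fun ω => ‖sampleMean (fun i => S i ω) (gradX f (xhat ω)
    (maximizer Y (empiricalRisk f (fun i => S i ω) (xhat ω))))‖ with ha
  set u : Ω → ℝ := fun ω => ‖sampleMean (fun i => S i ω) (gradX f xs ys)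
    - ∫ z, gradX f xs ys z ∂P‖ with hu
  set v : Ω → ℝ := fun ω => ‖sampleMean (fun i => S i ω) (gradY f xs ys)
    - ∫ z, gradY f xs ys z ∂P‖ with hv
  set η : ℝ := (2 * L + ε) / n with hη
  have hA : Q.real (Ax ∪ Ay) ≤ (deviationConstant d d D L ε + deviationConstant d d' D L ε)
      / (n : ℝ) ^ 2 := by
    rw [add_div]
    exact (measureReal_union_le _ _).trans (add_le_add hAx hAy)
  -- On the exceptional event the gap is at most `M`; elsewhere the absorption lemma applies.
  have hpoint : ∀ ω, G ω ≤ 2 / μx * a ω ^ 2 + 6 / μx * u ω ^ 2 + 6 * κ ^ 2 / μx * v ω ^ 2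
      + 12 * (1 + κ) ^ 2 / μx * η ^ 2 + (Ax ∪ Ay).indicator (fun _ => M) ω := by
    intro ω
    by_cases hω : ω ∈ Ax ∪ Ay
    · rw [Set.indicator_of_mem hω]
      have h1 : G ω ≤ M := hM _ (hX ω)
      have h2 : 0 ≤ 2 / μx * a ω ^ 2 + 6 / μx * u ω ^ 2 + 6 * κ ^ 2 / μx * v ω ^ 2
        + 12 * (1 + κ) ^ 2 / μx * η ^ 2 := by positivity
      linarith
    · rw [Set.indicator_of_notMem hω, add_zero]
      rw [Set.mem_union, not_or] at hω
      have hux := hdevx ω hω.1 _ (hX ω)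
      have hvx := hdevy ω hω.2 _ (hX ω)
      refine gap_le_of_gradient_deviation (r := ‖xhat ω - xs‖) hμx hc hκ0.le (norm_nonneg _)
        (norm_nonneg _) (norm_nonneg _)
        (hpop.primal_sub_le hf.compact_X hf.convex_X hXi hYc hne hpl (hX ω) hxs)
        (hpop.norm_gradient_primal_le hY hYc hne hβ hμy (hsad ω) (hX ω)) ?_ ?_
        (hgrowth _ (hX ω)) hεsq
      · exact (norm_le_norm_add_norm_sub' _ _).trans (add_le_add_right hux _)
      · exact (norm_le_norm_add_norm_sub' _ _).trans (add_le_add_right hvx _)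
  have hI1 : Integrable (fun ω => 2 / μx * a ω ^ 2) Q := hintS.const_mul _
  have hI2 : Integrable (fun ω => 6 / μx * u ω ^ 2) Q := hu_int.const_mul _
  have hI3 : Integrable (fun ω => 6 * κ ^ 2 / μx * v ω ^ 2) Q := hv_int.const_mul _
  have hI4 : Integrable (fun _ : Ω => 12 * (1 + κ) ^ 2 / μx * η ^ 2) Q := integrable_const _
  have hI5 : Integrable ((Ax ∪ Ay).indicator fun _ => M) Q :=
    (integrable_const M).indicator (hAxm.union hAym)
  have hI12 : Integrable (fun ω => 2 / μx * a ω ^ 2 + 6 / μx * u ω ^ 2) Q := hI1.add hI2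
  have hI123 : Integrable (fun ω => 2 / μx * a ω ^ 2 + 6 / μx * u ω ^ 2
    + 6 * κ ^ 2 / μx * v ω ^ 2) Q := hI12.add hI3
  have hI1234 : Integrable (fun ω => 2 / μx * a ω ^ 2 + 6 / μx * u ω ^ 2
    + 6 * κ ^ 2 / μx * v ω ^ 2 + 12 * (1 + κ) ^ 2 / μx * η ^ 2) Q := hI123.add hI4
  have hint := integral_mono hintΦ (hI1234.add hI5) hpoint
  simp only [Pi.add_apply] at hint
  rw [integral_add hI1234 hI5, integral_add hI123 hI4, integral_add hI12 hI3, integral_add hI1 hI2,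
    integral_const_mul, integral_const_mul, integral_const_mul, integral_const,
    integral_indicator_const _ (hAxm.union hAym), probReal_univ, one_smul, smul_eq_mul] at hint
  have ha0 : 0 ≤ ∫ ω, a ω ^ 2 ∂Q := integral_nonneg fun ω => by positivity
  have h1 : 2 / μx * ∫ ω, a ω ^ 2 ∂Q ≤ 8 * (∫ ω, a ω ^ 2 ∂Q) / μx := by
    rw [div_mul_eq_mul_div]; gcongr; norm_num
  have h2 : 6 / μx * ∫ ω, u ω ^ 2 ∂Q ≤ 6 / μx * ((∫ z, ‖gradX f xs ys z‖ ^ 2 ∂P) / n) := by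
    gcongr
  have h3 : 6 * κ ^ 2 / μx * ∫ ω, v ω ^ 2 ∂Q
      ≤ 6 * κ ^ 2 / μx * ((∫ z, ‖gradY f xs ys z‖ ^ 2 ∂P) / n) := by
    gcongr
  have h4 : Q.real (Ax ∪ Ay) * M ≤ (deviationConstant d d D L ε + deviationConstant d d' D L ε)
      / (n : ℝ) ^ 2 * M := by gcongr
  have h5 : 6 / μx * ((∫ z, ‖gradX f xs ys z‖ ^ 2 ∂P) / n)
      + 6 * κ ^ 2 / μx * ((∫ z, ‖gradY f xs ys z‖ ^ 2 ∂P) / n)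
      = 6 * ((∫ z, ‖gradX f xs ys z‖ ^ 2 ∂P) / (μx * n)
              + β ^ 2 * (∫ z, ‖gradY f xs ys z‖ ^ 2 ∂P) / (μx * μy ^ 2 * n)) := by
    rw [hκ]; field_simp
  have h6 : 12 * (1 + κ) ^ 2 / μx * η ^ 2 + (deviationConstant d d D L ε
      + deviationConstant d d' D L ε) / (n : ℝ) ^ 2 * M
      ≤ remainderConstant d d' β μx μy c D M / (n : ℝ) ^ 2 := by
    have : remainderConstant d d' β μx μy c D M / (n : ℝ) ^ 2
        = 12 * (1 + κ) ^ 2 / μx * η ^ 2 + (deviationConstant d d D L ε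
      + deviationConstant d d' D L ε) / (n : ℝ) ^ 2 * M + 1 / (n : ℝ) ^ 2 := by
      rw [remainderConstant, ← hκ, ← hL, ← hε, hη]
      ring
    rw [this]
    have : 0 < 1 / (n : ℝ) ^ 2 := by positivity
    linarith
  linarith

end ExcessRisk

end

/-! ### The theorem. -/

theorem mainTheorem8 :
    -- an absolute constant
    ∃ C₁ : ℝ, 0 < C₁ ∧
    ∀ (d d' : ℕ) (X : Set (Euc d)) (Y : Set (Euc d')) (F : Euc d → Euc d' → ℝ)
      (xs : Euc d) (ys : Euc d') (β μx μy Bx By : ℝ),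
      0 < β → 0 < μx → 0 < μy → 0 < Bx → 0 < By →
      IsPLX F X Y μx →
      IsMinimaxSolution F X Y xs ys →
    -- a constant that does not depend on the cost `f`, its distribution, `n`, the sample or `xhat`
    ∃ C₂ : ℝ, 0 < C₂ ∧
    ∀ (Z : Type*) [MeasurableSpace Z] (P : Measure Z) [IsProbabilityMeasure P]
      (f : Euc d → Euc d' → Z → ℝ),
      IsNCSC f X Y β μy →
      IsRegularCost P f X Y →
      (∀ x ∈ X, ∀ y ∈ Y, F x y = populationRisk P f x y) →
      BernsteinCondition P (gradX f xs ys) Bx →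
      BernsteinCondition P (gradY f xs ys) By →
    ∀ (n : ℕ), 1 ≤ n →
    -- an i.i.d. sample `S = (z₁, …, zₙ)` from `P`, and any random point `xhat` of `X`
    ∀ (Ω : Type*) [MeasurableSpace Ω] (Q : Measure Ω) [IsProbabilityMeasure Q]
      (S : Fin n → Ω → Z),
      (∀ i, Measurable (S i)) → (∀ i, Q.map (S i) = P) → iIndepFun S Q →
    ∀ xhat : Ω → Euc d, Measurable xhat → (∀ ω, xhat ω ∈ X) →
      Integrable (fun ω => primal Y F (xhat ω) - primal Y F xs) Q ∧
      Integrable (fun ω =>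
        ‖gradientWithin (primal Y (empiricalRisk f (fun i => S i ω))) X (xhat ω)‖ ^ 2) Q ∧
      ∫ ω, (primal Y F (xhat ω) - primal Y F xs) ∂Q
        ≤ 8 * (∫ ω,
            ‖gradientWithin (primal Y (empiricalRisk f (fun i => S i ω))) X (xhat ω)‖ ^ 2 ∂Q) / μx
          + C₁ * ((∫ z, ‖gradX f xs ys z‖ ^ 2 ∂P) / (μx * n)
              + β ^ 2 * (∫ z, ‖gradY f xs ys z‖ ^ 2 ∂P) / (μx * μy ^ 2 * n))
          + C₂ / (n : ℝ) ^ 2 := by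
  refine ⟨6, by norm_num, fun d d' X Y F xs ys β μx μy Bx By hβ hμx hμy _ _ hpl hsol => ?_⟩
  -- `C₂` must be chosen before the cost, but the regularity of `F` behind these bounds is known
  -- only through a cost. If no such bounds exist, no admissible cost exists either, and any
  -- constant will do.
  by_cases hb : ∃ c D M : ℝ, HasPopulationBounds F X Y xs c D M
  · obtain ⟨c, D, M, hb⟩ := hb
    refine ⟨remainderConstant d d' β μx μy c D M, remainderConstant_pos hμx hb.2.1, ?_⟩
    intro Z _ P _ f hf hr hF hBx hBy n hn Ω _ Q _ S hSm hSP hSi xhat hm hX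
    -- The case `k = 2` of the Bernstein conditions supplies square integrability of the gradients
    -- at the solution.
    exact integral_primal_gap_le hβ hμx hμy hpl hsol hb hf hr hF (hBx 2 le_rfl).1 (hBy 2 le_rfl).1
      hn ⟨hSm, hSP, hSi⟩ hm hX
  · refine ⟨1, one_pos, ?_⟩
    intro Z _ P _ f hf hr hF hBx hBy
    exact absurd ((isSaddleObjective_population hf hβ hr hF (interior_subset hsol.mem_interior)
      hsol.mem_Y (hBx 2 le_rfl).1 (hBy 2 le_rfl).1).exists_hasPopulationBounds hβ hμy
      hf.compact_X hf.convex_X hf.compact_Y hf.convex_Y hμx hpl hsol) hb
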